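/- Let $K$ be an algebraically closed field of characteristic $0$, and let $A_1$ be the Weyl algebra over $K$, i.e. the associative unital $K$-algebra generated by $X,Y$ with the single relation $[Y,X]=1$. Let $\Psi\colon A_1\to K[x,y]$ be the $K$-linear isomorphism with $\Psi(X^iY^j)=x^iy^j$. **Notation.** For $(\rho,\sigma)\in\mathbb Z^2$ and a point $(i,j)\in\mathbb Z^2$ put $v_{\rho,\sigma}(i,j)=\rho i+\sigma j$. For $P\in A_1\setminus\{0\}$ with $\Psi(P)=\sum a_{ij}x^iy^j$ put $\mathrm{Supp}(P)=\{(i,j):a_{ij}\neq0\}$, let $v_{\rho,\sigma}(P)$ be the maximum of $v_{\rho,\sigma}$ on $\mathrm{Supp}(P)$, and let $\ell_{\rho,\sigma}(P)\in K[x,y]$ be the sum of the terms $a_{ij}x^iy^j$ with $v_{\rho,\sigma}(i,j)=v_{\rho,\sigma}(P)$; also $v_{\rho,\sigma}(0)=-\infty$. Let $\mathfrak V=\{(\rho,\sigma)\in\mathbb Z^2:\gcd(\rho,\sigma)=1,\ \rho+\sigma>0\}$ and let $\mathrm{Dir}(P)$ be the set of all $(\rho,\sigma)\in\mathfrak V$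 such that $\ell_{\rho,\sigma}(P)$ has at least two terms. For $(\rho,\sigma)\in\mathfrak V$, the starting point $\mathrm{st}_{\rho,\sigma}(P)$ is the point $(i,j)$ of the support of $\ell_{\rho,\sigma}(P)$ at which $i-j$ is largest, and the end point $\mathrm{en}_{\rho,\sigma}(P)$ is the one at which $j-i$ is largest. The bracket $[P,Q]_{\rho,\sigma}$ is $0$ if $v_{\rho,\sigma}([P,Q])<v_{\rho,\sigma}(P)+v_{\rho,\sigma}(Q)-(\rho+\sigma)$, and is $\ell_{\rho,\sigma}([P,Q])$ otherwise. **Standard minimal pairs.** A counterexample (to the Dixmier conjecture over $K$) is a pair $(P,Q)$ of elements of $A_1$ such that $X\mapsto P$, $Y\mapsto Q$ defines an algebra endomorphism of $A_1$ that is not an automorphism. Let $B$ be the minimum of $\gcd(v_{1,1}(P),v_{1,1}(Q))$ over all counterexamples ($B=\infty$ if there are none). A minimal pair is a counterexample $(P,Q)$ with $\gcd(v_{1,1}(P),v_{1,1}(Q))=B$. An element $P\in A_1$ is subrectangular if there are positive integers $a,b$ with $(a,b)\in\mathrm{Supp}(P)\subseteq\{(i,j):0\le i\le a,\ 0\le j\le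 b\}$. A standard minimal pair is a minimal pair $(P,Q)$ such that $P$ and $Q$ are subrectangular, $v_{1,-1}(\mathrm{st}_{1,0}(P))<0$ and $v_{1,-1}(\mathrm{st}_{1,0}(Q))<0$. **Proposition.** For each standard minimal pair $(P,Q)$ there exists $(\rho,\sigma)\in\mathrm{Dir}(P)\cap\mathrm{Dir}(Q)$ such that 1. $\sigma<0$; 2. $v_{\rho,\sigma}(P)>0$ and $v_{\rho,\sigma}(Q)>0$; 3. $[P,Q]_{\rho,\sigma}=0$; 4. $\dfrac{v_{\rho,\sigma}(P)}{v_{\rho,\sigma}(Q)}=\dfrac{v_{1,1}(P)}{v_{1,1}(Q)}$; 5. $\dfrac{v_{\rho,\sigma}(Q)}{v_{\rho,\sigma}(P)}\notin\mathbb N$ and $\dfrac{v_{\rho,\sigma}(P)}{v_{\rho,\sigma}(Q)}\notin\mathbb N$; 6. $v_{1,-1}(\mathrm{st}_{\rho,\sigma}(P))>0$ and $v_{1,-1}(\mathrm{en}_{\rho,\sigma}(P))<0$. -/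

import Mathlib

noncomputable section

namespace Dixmier

/-! ### The Weyl algebra and its normally ordered symbols -/

/-- The defining relation `[Y, X] = 1`, where `X` is the generator `0` and `Y` the generator `1`. -/
inductive WeylRel (K : Type*) [Field K] :
    FreeAlgebra K (Fin 2) → FreeAlgebra K (Fin 2) → Prop
  | comm : WeylRel K
      (FreeAlgebra.ι K 1 * FreeAlgebra.ι K 0 - FreeAlgebra.ι K 0 * FreeAlgebra.ι K 1) 1

/-- The first Weyl algebra `A₁` over `K`: the free algebra on `X`, `Y` modulo `[Y, X] = 1`. -/
abbrev Weyl (K : Type*) [Field K] : Type _ := RingQuot (WeylRel K)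

variable (K : Type*) [Field K]

/-- The generator `X` of the Weyl algebra. -/
def Weyl.X : Weyl K := RingQuot.mkAlgHom K (WeylRel K) (FreeAlgebra.ι K 0)

/-- The generator `Y` of the Weyl algebra. -/
def Weyl.Y : Weyl K := RingQuot.mkAlgHom K (WeylRel K) (FreeAlgebra.ι K 1)

/-- The commutative polynomial algebra `K[x, y]`, with `x` the variable `0`, `y` the variable `1`. -/
abbrev Poly2 : Type _ := MvPolynomial (Fin 2) K

/-- Left multiplication by `x` on `K[x, y]`. -/
def opX : Module.End K (Poly2 K) := LinearMap.mulLeft K (MvPolynomial.X 0)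

/-- The operator `y + ∂/∂x` on `K[x, y]`. -/
def opY : Module.End K (Poly2 K) :=
  LinearMap.mulLeft K (MvPolynomial.X 1) + (MvPolynomial.pderiv 0).toLinearMap

theorem opY_comm_opX : opY K * opX K - opX K * opY K = 1 := by
  refine LinearMap.ext fun f => ?_
  simp [opX, opY]
  ring

/-- The representation of the Weyl algebra on `K[x, y]` in which `X` acts as `x` and `Y` as
`y + ∂/∂x`. -/
def Weyl.rep : Weyl K →ₐ[K] Module.End K (Poly2 K) :=
  RingQuot.liftAlgHom K ⟨FreeAlgebra.lift K ![opX K, opY K], by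
    intro a b h
    cases h
    simpa using opY_comm_opX K⟩

variable {K}

/-- The `K`-linear map `Ψ : A₁ → K[x, y]` with `Ψ (X ^ i * Y ^ j) = x ^ i * y ^ j`
(see `Weyl.symbol_monomial` and `Weyl.symbol_bijective`). -/
def Weyl.symbol : Weyl K →ₗ[K] Poly2 K :=
  (LinearMap.applyₗ (1 : Poly2 K)).comp (Weyl.rep K).toLinearMap

theorem Weyl.rep_X : Weyl.rep K (Weyl.X K) = opX K := by
  simp [Weyl.rep, Weyl.X]

theorem Weyl.rep_Y : Weyl.rep K (Weyl.Y K) = opY K := by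
  simp [Weyl.rep, Weyl.Y]

theorem Weyl.Y_mul_X : Weyl.Y K * Weyl.X K = Weyl.X K * Weyl.Y K + 1 := by
  have h := RingQuot.mkAlgHom_rel K (WeylRel.comm (K := K))
  simp only [map_sub, map_mul, map_one] at h
  exact sub_eq_iff_eq_add'.mp h

theorem Weyl.Y_mul_X_pow (i : ℕ) :
    Weyl.Y K * Weyl.X K ^ i = Weyl.X K ^ i * Weyl.Y K + (i : K) • Weyl.X K ^ (i - 1) := by
  induction i with
  | zero => simp
  | succ n ih =>
    have hn : (n : K) • Weyl.X K ^ (n - 1) * Weyl.X K = (n : K) • Weyl.X K ^ n := by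
      cases n with
      | zero => simp
      | succ m => simp [pow_succ]
    rw [pow_succ, ← mul_assoc, ih, add_mul, mul_assoc, Weyl.Y_mul_X, hn, mul_add, mul_one,
      Nat.add_sub_cancel, Nat.cast_succ, add_smul, one_smul, ← mul_assoc]
    abel

theorem Weyl.symbol_monomial (i j : ℕ) :
    Weyl.symbol (Weyl.X K ^ i * Weyl.Y K ^ j) = MvPolynomial.X 0 ^ i * MvPolynomial.X 1 ^ j := by
  have hY : ∀ j : ℕ, (opY K ^ j) 1 = MvPolynomial.X 1 ^ j := by
    intro j
    induction j with
    | zero => simp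
    | succ n ih => rw [pow_succ', Module.End.mul_apply, ih]; simp [opY, pow_succ']
  have hX : ∀ (i : ℕ) (f : Poly2 K), (opX K ^ i) f = MvPolynomial.X 0 ^ i * f := by
    intro i f
    induction i with
    | zero => simp
    | succ n ih => rw [pow_succ', Module.End.mul_apply, ih]; simp [opX, pow_succ', mul_assoc]
  simp [Weyl.symbol, Weyl.rep_X, Weyl.rep_Y, hY, hX]

theorem Weyl.span_monomial :
    Submodule.span K (Set.range fun s : ℕ × ℕ => Weyl.X K ^ s.1 * Weyl.Y K ^ s.2) = ⊤ := by
  set S := Submodule.span K (Set.range fun s : ℕ × ℕ => Weyl.X K ^ s.1 * Weyl.Y K ^ s.2) with hS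
  have hmem : ∀ i j : ℕ, Weyl.X K ^ i * Weyl.Y K ^ j ∈ S := fun i j =>
    Submodule.subset_span ⟨(i, j), rfl⟩
  have hXS : ∀ b ∈ S, Weyl.X K * b ∈ S := by
    intro b hb
    refine Submodule.span_induction (p := fun b _ => Weyl.X K * b ∈ S) ?_ (by simp) ?_ ?_ hb
    · rintro _ ⟨⟨i, j⟩, rfl⟩
      simpa [pow_succ', mul_assoc] using hmem (i + 1) j
    · intro u v _ _ hu hv
      rw [mul_add]; exact S.add_mem hu hv
    · intro c u _ hu
      rw [mul_smul_comm]; exact S.smul_mem c hu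
  have hYS : ∀ b ∈ S, Weyl.Y K * b ∈ S := by
    intro b hb
    refine Submodule.span_induction (p := fun b _ => Weyl.Y K * b ∈ S) ?_ (by simp) ?_ ?_ hb
    · rintro _ ⟨⟨i, j⟩, rfl⟩
      dsimp only
      rw [← mul_assoc, Weyl.Y_mul_X_pow, add_mul, smul_mul_assoc, mul_assoc, ← pow_succ']
      exact S.add_mem (hmem i (j + 1)) (S.smul_mem _ (hmem (i - 1) j))
    · intro u v _ _ hu hv
      rw [mul_add]; exact S.add_mem hu hv
    · intro c u _ hu
      rw [mul_smul_comm]; exact S.smul_mem c hu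
  have key : ∀ (a : FreeAlgebra K (Fin 2)), ∀ b ∈ S, RingQuot.mkAlgHom K (WeylRel K) a * b ∈ S := by
    intro a
    induction a using FreeAlgebra.induction with
    | grade0 r =>
      intro b hb
      rw [AlgHom.commutes, ← Algebra.smul_def]
      exact S.smul_mem r hb
    | grade1 x =>
      fin_cases x
      · exact hXS
      · exact hYS
    | mul p q hp hq =>
      intro b hb
      rw [map_mul, mul_assoc]
      exact hp _ (hq b hb)
    | add p q hp hq =>
      intro b hb
      rw [map_add, add_mul]
      exact S.add_mem (hp b hb) (hq b hb)
  refine eq_top_iff.mpr fun a _ => ?_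
  obtain ⟨p, rfl⟩ := RingQuot.mkAlgHom_surjective K (WeylRel K) a
  simpa using key p 1 (by simpa using hmem 0 0)

theorem Weyl.symbol_bijective : Function.Bijective (Weyl.symbol (K := K)) := by
  let back : Poly2 K →ₗ[K] Weyl K :=
    (MvPolynomial.basisMonomials (Fin 2) K).constr K fun s => Weyl.X K ^ s 0 * Weyl.Y K ^ s 1
  have hmono : ∀ i j : ℕ, (MvPolynomial.X 0 ^ i * MvPolynomial.X 1 ^ j : Poly2 K) =
      MvPolynomial.monomial (Finsupp.single 0 i + Finsupp.single 1 j) 1 := by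
    intro i j
    rw [MvPolynomial.X_pow_eq_monomial, MvPolynomial.X_pow_eq_monomial,
      MvPolynomial.monomial_mul, one_mul]
  have hback : ∀ s : Fin 2 →₀ ℕ,
      back (MvPolynomial.monomial s 1) = Weyl.X K ^ s 0 * Weyl.Y K ^ s 1 := by
    intro s
    have := (MvPolynomial.basisMonomials (Fin 2) K).constr_basis K
      (fun s => Weyl.X K ^ s 0 * Weyl.Y K ^ s 1) s
    simpa [back] using this
  have h1 : back ∘ₗ Weyl.symbol = LinearMap.id := by
    refine LinearMap.ext_on_range (v := fun s : ℕ × ℕ => Weyl.X K ^ s.1 * Weyl.Y K ^ s.2)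
      Weyl.span_monomial ?_
    rintro ⟨i, j⟩
    simp [Weyl.symbol_monomial, hmono, hback]
  have h2 : Weyl.symbol ∘ₗ back = LinearMap.id := by
    refine (MvPolynomial.basisMonomials (Fin 2) K).ext fun s => ?_
    have hs : Finsupp.single 0 (s 0) + Finsupp.single 1 (s 1) = s := by
      ext k; fin_cases k <;> simp
    simp [hback, Weyl.symbol_monomial, hmono, hs]
  exact Function.bijective_iff_has_inverse.mpr
    ⟨back, fun a => LinearMap.congr_fun h1 a, fun p => LinearMap.congr_fun h2 p⟩

/-! ### Directions, degrees, leading terms, starting and end points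

A pair `(ρ, σ)` and a point of the plane are both elements of `ℤ × ℤ`. -/

/-- The set `𝔙` of directions: pairs of coprime integers with `ρ + σ > 0`. -/
def directions : Set (ℤ × ℤ) := {d | Int.gcd d.1 d.2 = 1 ∧ 0 < d.1 + d.2}

/-- `v_{ρ,σ}(i, j) = ρ i + σ j` for a point `(i, j)`. -/
def vPt (d a : ℤ × ℤ) : ℤ := d.1 * a.1 + d.2 * a.2

/-- The exponent of a monomial of `K[x, y]` as a point of the plane. -/
def expPt (s : Fin 2 →₀ ℕ) : ℤ × ℤ := ((s 0 : ℤ), (s 1 : ℤ))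

/-- The support of a polynomial as a set of points of the plane. -/
def supp (p : Poly2 K) : Finset (ℤ × ℤ) := p.support.image expPt

/-- The `(ρ, σ)`-degree of a polynomial, with `v_{ρ,σ}(0) = -∞`. -/
def vBot (d : ℤ × ℤ) (p : Poly2 K) : WithBot ℤ := p.support.sup fun s => (vPt d (expPt s) : WithBot ℤ)

/-- The `(ρ, σ)`-degree of a nonzero polynomial as an integer (and `0` for the zero polynomial). -/
def vInt (d : ℤ × ℤ) (p : Poly2 K) : ℤ := (vBot d p).unbotD 0

/-- The `(ρ, σ)`-leading term `ℓ_{ρ,σ}(p)`. -/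
def lead (d : ℤ × ℤ) (p : Poly2 K) : Poly2 K :=
  ∑ s ∈ p.support with (vPt d (expPt s) : WithBot ℤ) = vBot d p,
    MvPolynomial.monomial s (p.coeff s)

/-- `w(p) = (i₀, i₀ - v_{1,-1}(p))`, where `i₀` is the largest `i` such that
`(i, i - v_{1,-1}(p))` lies in the support of `ℓ_{1,-1}(p)`; meant for `p ≠ 0`. -/
def wPt (p : Poly2 K) : ℤ × ℤ :=
  let c := vInt (1, -1) p
  let i₀ := sSup {i : ℤ | (i, i - c) ∈ supp (lead (1, -1) p)}
  (i₀, i₀ - c)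

/-- `w̄(p) = (i₀ - v_{-1,1}(p), i₀)`, where `i₀` is the largest `i` such that
`(i - v_{-1,1}(p), i)` lies in the support of `ℓ_{-1,1}(p)`; meant for `p ≠ 0`. -/
def wbarPt (p : Poly2 K) : ℤ × ℤ :=
  let c := vInt (-1, 1) p
  let i₀ := sSup {i : ℤ | (i - c, i) ∈ supp (lead (-1, 1) p)}
  (i₀ - c, i₀)

namespace Weyl

/-- The support of an element of the Weyl algebra: the points `(i, j)` such that `X ^ i * Y ^ j`
occurs in it. -/
def support (P : Weyl K) : Finset (ℤ × ℤ) := supp (symbol P)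

/-- The `(ρ, σ)`-degree of a nonzero element of the Weyl algebra. -/
def deg (d : ℤ × ℤ) (P : Weyl K) : ℤ := vInt d (symbol P)

/-- The `(ρ, σ)`-leading term of an element of the Weyl algebra, an element of `K[x, y]`. -/
def ell (d : ℤ × ℤ) (P : Weyl K) : Poly2 K := lead d (symbol P)

/-- The starting point `st_{ρ,σ}(P) = w(ℓ_{ρ,σ}(P))`. -/
def st (d : ℤ × ℤ) (P : Weyl K) : ℤ × ℤ := wPt (ell d P)

/-- The end point `en_{ρ,σ}(P) = w̄(ℓ_{ρ,σ}(P))`. -/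
def en (d : ℤ × ℤ) (P : Weyl K) : ℤ × ℤ := wbarPt (ell d P)

/-- The set `Dir(P)` of directions `(ρ, σ)` such that `ℓ_{ρ,σ}(P)` has more than one point in its
support. -/
def Dir (P : Weyl K) : Set (ℤ × ℤ) := {d | d ∈ directions ∧ 1 < (supp (ell d P)).card}

/-- `P` and `Q` are `(ρ, σ)`-proportional:
`v_{ρ,σ}([P, Q]) < v_{ρ,σ}(P) + v_{ρ,σ}(Q) - (ρ + σ)`. -/
def IsProportional (d : ℤ × ℤ) (P Q : Weyl K) : Prop :=
  vBot d (symbol (P * Q - Q * P)) + ((d.1 + d.2 : ℤ) : WithBot ℤ) <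
    vBot d (symbol P) + vBot d (symbol Q)

open Classical in
/-- The bracket `[P, Q]_{ρ,σ}`. -/
def bracket (d : ℤ × ℤ) (P Q : Weyl K) : Poly2 K :=
  if IsProportional d P Q then 0 else ell d (P * Q - Q * P)

/-- `P` is subrectangular: for some positive integers `a`, `b`, the point `(a, b)` belongs to the
support of `P`, which is contained in the rectangle `[0, a] × [0, b]`. -/
def IsSubrectangular (P : Weyl K) : Prop :=
  ∃ a b : ℕ, 0 < a ∧ 0 < b ∧ ((a : ℤ), (b : ℤ)) ∈ support P ∧
    ∀ s ∈ support P, 0 ≤ s.1 ∧ s.1 ≤ a ∧ 0 ≤ s.2 ∧ s.2 ≤ b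

/-- `(P, Q)` is a counterexample to the Dixmier conjecture: `P` and `Q` are the images of `X` and
`Y` under an algebra endomorphism of the Weyl algebra that is not an automorphism. -/
def IsCounterexample (P Q : Weyl K) : Prop :=
  ∃ φ : Weyl K →ₐ[K] Weyl K, φ (X K) = P ∧ φ (Y K) = Q ∧ ¬ Function.Bijective φ

variable (K) in
/-- The minimum `B` of `gcd (v_{1,1}(P), v_{1,1}(Q))` over all counterexamples `(P, Q)`, which is
`∞` if there are none. -/
def minGcd : ℕ∞ :=
  ⨅ (P : Weyl K) (Q : Weyl K) (_ : IsCounterexample P Q),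
    ((Int.gcd (deg (1, 1) P) (deg (1, 1) Q) : ℕ) : ℕ∞)

/-- A minimal pair: a counterexample `(P, Q)` with `gcd (v_{1,1}(P), v_{1,1}(Q)) = B`. -/
def IsMinimalPair (P Q : Weyl K) : Prop :=
  IsCounterexample P Q ∧ minGcd K = ((Int.gcd (deg (1, 1) P) (deg (1, 1) Q) : ℕ) : ℕ∞)

/-- A standard minimal pair: a minimal pair of subrectangular elements with
`v_{1,-1}(st_{1,0}(P)) < 0` and `v_{1,-1}(st_{1,0}(Q)) < 0`. -/
def IsStandardMinimalPair (P Q : Weyl K) : Prop :=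
  IsMinimalPair P Q ∧ IsSubrectangular P ∧ IsSubrectangular Q ∧
    vPt (1, -1) (st (1, 0) P) < 0 ∧ vPt (1, -1) (st (1, 0) Q) < 0

end Weyl

end Dixmier

end

/-! Refine `v_{ρ,σ}` lexicographically by `v_{1,-1}` or `v_{-1,1}`. The weight is then injective on
monomials, so a nonzero element has a unique leading exponent: its starting or end point. If P and Q
have leading exponents u and v, then [P, Q] has the term `u₁v₀ - v₁u₀` at u + v - (1,1). Since [P,
Q] = -1 is constant, u and v are parallel unless u + v = (1,1).

Subrectangularity makes the corners of P and Q parallel, so the starting points on their right edges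
are in the ratio `v_{1,1}(P) : v_{1,1}(Q)`. Turning the direction from (1,0) towards (1,-1), the old
vertices still attain the maximum whenever an edge is met, so the new ones, being parallel, inherit
that ratio (`proportional_of_proportional`). Both degrees are therefore positive in every direction
with σ ≤ 0. Near (1,-1) this forces the support of P to reach the diagonal or go below it, while the
top of its right edge lies above. Some edge thus crosses the diagonal, and its direction is the one
sought.

The starting point of that edge is not on the diagonal (`HasTop.ne_diag`). If P had leading monomial
(xy)^i with i > 0, then Q would have a diagonal leading monomial too. Replacing Q by Q^i minus a
multiple of a power of P cancels the leading term, keeps the commutator with P diagonal, and shrinks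
the gap between the expected and the actual weight of that commutator; this cannot go on forever.

Minimality excludes integral ratios (`deg_ne_mul_of_forall_dvd`): if `v_{1,1}(P)` divided
`v_{1,1}(Q)`, it would equal B and divide `v_{1,1}(R)` for every counterexample (P, R), so multiples
of powers of P could be subtracted from Q endlessly. -/

namespace Dixmier

open MvPolynomial
open scoped Pointwise

/-! ### Weight filtrations and the symbol of a product up to second order. -/

section Filtration

set_option linter.unusedSectionVars false

variable {K : Type*} [Field K]
variable {Γ : Type*} [AddCommGroup Γ] [LinearOrder Γ] [IsOrderedAddMonoid Γ]

/-- The polynomials all of whose exponents have weight at most `γ`. -/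
noncomputable def degLE (φ : (Fin 2 →₀ ℕ) →+ Γ) (γ : Γ) : Submodule K (Poly2 K) :=
  restrictSupport K {s | φ s ≤ γ}

theorem mem_degLE {φ : (Fin 2 →₀ ℕ) →+ Γ} {γ : Γ} {p : Poly2 K} :
    p ∈ degLE φ γ ↔ ∀ s, p.coeff s ≠ 0 → φ s ≤ γ := by
  simp [degLE, mem_restrictSupport_iff, Set.subset_def, mem_support_iff]

/-- The weight of the point `(1, 1)`. -/
noncomputable def diagWt (φ : (Fin 2 →₀ ℕ) →+ Γ) : Γ := φ (Finsupp.single 0 1) + φ (Finsupp.single 1 1)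

variable {φ : (Fin 2 →₀ ℕ) →+ Γ}

theorem degLE_mono {α β : Γ} (h : α ≤ β) : degLE (K := K) φ α ≤ degLE φ β :=
  restrictSupport_mono _ fun _ hs => le_trans hs h

theorem monomial_mem_degLE {s : Fin 2 →₀ ℕ} {c : K} {γ : Γ} (h : φ s ≤ γ) :
    monomial s c ∈ degLE φ γ :=
  (monomial_mem_restrictSupport K).2 (Or.inl h)

theorem mul_mem_degLE {p q : Poly2 K} {α β : Γ} (hp : p ∈ degLE φ α) (hq : q ∈ degLE φ β) :
    p * q ∈ degLE φ (α + β) := by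
  have h : p * q ∈ restrictSupport K ({s | φ s ≤ α} + {s | φ s ≤ β}) := by
    rw [restrictSupport_add]
    exact Submodule.mul_mem_mul hp hq
  refine restrictSupport_mono K ?_ h
  rintro _ ⟨s, hs, t, ht, rfl⟩
  simpa using add_le_add hs ht

theorem pderiv_mem_degLE (i : Fin 2) {p : Poly2 K} {α : Γ} (hp : p ∈ degLE φ α) :
    pderiv i p ∈ degLE φ (α - φ (Finsupp.single i 1)) := by
  rw [mem_degLE] at hp ⊢
  intro s hs
  rw [coeff_pderiv] at hs
  have := hp _ (left_ne_zero_of_mul hs)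
  rwa [map_add, ← le_sub_iff_add_le] at this

theorem X_mul_mem_degLE (i : Fin 2) {p : Poly2 K} {α : Γ} (hp : p ∈ degLE φ α) :
    X i * p ∈ degLE φ (φ (Finsupp.single i 1) + α) :=
  mul_mem_degLE (monomial_mem_degLE le_rfl) hp

theorem X_pow_mem_degLE (i : Fin 2) (n : ℕ) :
    (X i : Poly2 K) ^ n ∈ degLE φ (n • φ (Finsupp.single i 1)) := by
  rw [X_pow_eq_monomial]
  refine monomial_mem_degLE (le_of_eq ?_)
  rw [← map_nsmul]
  simp

/-- In the expansion of (y + ∂/∂x)^b each derivative replaces a factor y and lowers the exponent of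
x, which costs `diagWt φ`. The remainder collects the terms with at least two derivatives. -/
theorem opY_pow_apply (hE : 0 < diagWt φ) {q : Poly2 K} {β : Γ} (hq : q ∈ degLE φ β) (b : ℕ) :
    (opY K ^ b) q - X 1 ^ b * q - (b : Poly2 K) * X 1 ^ (b - 1) * pderiv 0 q ∈
      degLE φ (b • φ (Finsupp.single 1 1) + β - (2 : ℕ) • diagWt φ) := by
  induction b with
  | zero => simp
  | succ b ih =>
    set r := (opY K ^ b) q - X 1 ^ b * q - (b : Poly2 K) * X 1 ^ (b - 1) * pderiv 0 q with hr
    have hb : (opY K ^ b) q = X 1 ^ b * q + (b : Poly2 K) * X 1 ^ (b - 1) * pderiv 0 q + r := by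
      rw [hr]; ring
    have hX : (X 1 : Poly2 K) * ((b : Poly2 K) * X 1 ^ (b - 1)) = (b : Poly2 K) * X 1 ^ b := by
      cases b with
      | zero => simp
      | succ b => simp [pow_succ]; ring
    have hd : ∀ n : ℕ, pderiv 0 ((X 1 : Poly2 K) ^ n) = 0 := fun n => by
      rw [pderiv_pow, pderiv_X_of_ne (by decide), mul_zero]
    have hc : pderiv 0 ((b : Poly2 K)) = 0 := by
      rw [← map_natCast (C : K →+* Poly2 K), pderiv_C]
    have key : (opY K ^ (b + 1)) q - X 1 ^ (b + 1) * q -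
        ((b + 1 : ℕ) : Poly2 K) * X 1 ^ (b + 1 - 1) * pderiv 0 q =
        (b : Poly2 K) * X 1 ^ (b - 1) * pderiv 0 (pderiv 0 q) + X 1 * r + pderiv 0 r := by
      rw [pow_succ', Module.End.mul_apply, hb]
      simp only [opY, LinearMap.add_apply, LinearMap.mulLeft_apply, Derivation.coeFn_coe,
        map_add, pderiv_mul, hd, hc, Nat.add_sub_cancel, Nat.cast_add, Nat.cast_one]
      linear_combination (pderiv 0 q) * hX
    rw [key]
    refine add_mem (add_mem ?_ ?_) ?_
    · cases b with
      | zero => simp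
      | succ b =>
        rw [mul_assoc, ← map_natCast (C : K →+* Poly2 K), ← smul_eq_C_mul]
        refine Submodule.smul_mem _ _ (degLE_mono (le_of_eq ?_)
          (mul_mem_degLE (X_pow_mem_degLE 1 b) (pderiv_mem_degLE 0 (pderiv_mem_degLE 0 hq))))
        rw [diagWt]; simp only [add_smul, one_smul, smul_add, two_smul]; abel
    · refine degLE_mono (le_of_eq ?_) (X_mul_mem_degLE 1 ih)
      rw [add_smul, one_smul]; abel
    · refine degLE_mono ?_ (pderiv_mem_degLE 0 ih)
      rw [← sub_nonneg]
      refine hE.le.trans (le_of_eq ?_)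
      rw [diagWt, add_smul, one_smul]; abel

theorem monomial_fin_two (s : Fin 2 →₀ ℕ) (c : K) :
    monomial s c = C c * (X 0 ^ s 0 * X 1 ^ s 1) := by
  rw [monomial_eq, Finsupp.prod_fintype _ _ (by simp), Fin.prod_univ_two]

theorem rep_monomial (hE : 0 < diagWt φ) {q : Poly2 K} {β : Γ} (hq : q ∈ degLE φ β)
    (s : Fin 2 →₀ ℕ) :
    Weyl.rep K (Weyl.X K ^ s 0 * Weyl.Y K ^ s 1) q - monomial s 1 * q -
      pderiv 1 (monomial s 1) * pderiv 0 q ∈ degLE φ (φ s + β - (2 : ℕ) • diagWt φ) := by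
  have hX : ∀ (i : ℕ) (f : Poly2 K), (opX K ^ i) f = X 0 ^ i * f := by
    intro i f
    induction i with
    | zero => simp
    | succ n ih => rw [pow_succ', Module.End.mul_apply, ih]; simp [opX, pow_succ', mul_assoc]
  have hd : pderiv 1 ((X 0 : Poly2 K) ^ s 0) = 0 := by
    rw [pderiv_pow, pderiv_X_of_ne (by decide), mul_zero]
  have hs : φ s = s 0 • φ (Finsupp.single 0 1) + s 1 • φ (Finsupp.single 1 1) := by
    rw [← map_nsmul, ← map_nsmul, ← map_add]
    congr 1
    ext k; fin_cases k <;> simp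
  have h := mul_mem_degLE (X_pow_mem_degLE (φ := φ) (K := K) 0 (s 0)) (opY_pow_apply hE hq (s 1))
  rw [hs]
  convert h using 1
  rotate_left
  · rw [map_mul, map_pow, map_pow, Weyl.rep_X, Weyl.rep_Y, Module.End.mul_apply, hX,
      monomial_fin_two, C_1, one_mul, pderiv_mul, hd, pderiv_pow, pderiv_X_self]
    ring
  · congr 1; abel


theorem Weyl.eq_sum (P : Weyl K) :
    P = ∑ s ∈ (Weyl.symbol P).support,
      (Weyl.symbol P).coeff s • (Weyl.X K ^ s 0 * Weyl.Y K ^ s 1) := by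
  apply Weyl.symbol_bijective.1
  rw [map_sum]
  conv_lhs => rw [(Weyl.symbol P).as_sum]
  refine Finset.sum_congr rfl fun s _ => ?_
  rw [map_smul, Weyl.symbol_monomial, monomial_fin_two, smul_eq_C_mul]

theorem Weyl.symbol_mul (P Q : Weyl K) :
    Weyl.symbol (P * Q) = Weyl.rep K P (Weyl.symbol Q) := by
  simp [Weyl.symbol]

theorem Weyl.symbol_one : Weyl.symbol (1 : Weyl K) = 1 := by
  simp [Weyl.symbol]

/-- The first-order term is kept because the commutative product cancels in a commutator. -/
theorem symbol_mul_sub_mul_add_mem (hE : 0 < diagWt φ) {P Q : Weyl K} {α β : Γ}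
    (hP : Weyl.symbol P ∈ degLE φ α) (hQ : Weyl.symbol Q ∈ degLE φ β) :
    Weyl.symbol (P * Q) - (Weyl.symbol P * Weyl.symbol Q +
      pderiv 1 (Weyl.symbol P) * pderiv 0 (Weyl.symbol Q)) ∈
      degLE φ (α + β - (2 : ℕ) • diagWt φ) := by
  set p := Weyl.symbol P with hp
  set q := Weyl.symbol Q with hq
  have h : Weyl.symbol (P * Q) - (p * q + pderiv 1 p * pderiv 0 q) =
      ∑ s ∈ p.support, p.coeff s •
        (Weyl.rep K (Weyl.X K ^ s 0 * Weyl.Y K ^ s 1) q - monomial s 1 * q -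
          pderiv 1 (monomial s 1) * pderiv 0 q) := by
    have e1 : Weyl.symbol (P * Q) = ∑ s ∈ p.support, p.coeff s •
        Weyl.rep K (Weyl.X K ^ s 0 * Weyl.Y K ^ s 1) q := by
      rw [Weyl.symbol_mul]
      conv_lhs => rw [Weyl.eq_sum P]
      simp [← hp, ← hq]
    have e2 : p = ∑ s ∈ p.support, p.coeff s • monomial s (1 : K) := by
      conv_lhs => rw [p.as_sum]
      simp [smul_monomial]
    have e3 : pderiv 1 p = ∑ s ∈ p.support, p.coeff s • pderiv 1 (monomial s (1 : K)) := by
      conv_lhs => rw [e2]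
      rw [map_sum]
      exact Finset.sum_congr rfl fun s _ => Derivation.map_smul _ _ _
    simp only [smul_sub, Finset.sum_sub_distrib, ← smul_mul_assoc, ← Finset.sum_mul]
    rw [← e2, ← e3, ← e1, sub_sub]
  rw [h]
  refine sum_mem fun s hs => Submodule.smul_mem _ _ (degLE_mono ?_ (rep_monomial hE hQ s))
  have := mem_degLE.1 hP s (mem_support_iff.1 hs)
  gcongr

theorem symbol_mul_sub_mul_mem (hE : 0 < diagWt φ) {P Q : Weyl K} {α β : Γ}
    (hP : Weyl.symbol P ∈ degLE φ α) (hQ : Weyl.symbol Q ∈ degLE φ β) :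
    Weyl.symbol (P * Q) - Weyl.symbol P * Weyl.symbol Q ∈ degLE φ (α + β - diagWt φ) := by
  have h1 := symbol_mul_sub_mul_add_mem hE hP hQ
  have h2 := mul_mem_degLE (pderiv_mem_degLE 1 hP) (pderiv_mem_degLE 0 hQ)
  have h3 := add_mem (degLE_mono (K := K) (φ := φ) (?_ : _ ≤ α + β - diagWt φ) h1)
    (degLE_mono (?_ : _ ≤ α + β - diagWt φ) h2)
  · convert h3 using 1; ring
  · rw [two_smul, ← sub_sub]; exact sub_le_self _ hE.le
  · rw [diagWt]; apply le_of_eq; abel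

/-- The Poisson bracket which is the leading part of the commutator of `A₁`. -/
noncomputable def poisson (p q : Poly2 K) : Poly2 K := pderiv 1 p * pderiv 0 q - pderiv 1 q * pderiv 0 p

theorem poisson_mem_degLE {p q : Poly2 K} {α β : Γ}
    (hp : p ∈ degLE φ α) (hq : q ∈ degLE φ β) :
    poisson p q ∈ degLE φ (α + β - diagWt φ) := by
  refine sub_mem ?_ ?_
  · refine degLE_mono (le_of_eq ?_) (mul_mem_degLE (pderiv_mem_degLE 1 hp) (pderiv_mem_degLE 0 hq))
    rw [diagWt]; abel
  · refine degLE_mono (le_of_eq ?_) (mul_mem_degLE (pderiv_mem_degLE 1 hq) (pderiv_mem_degLE 0 hp))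
    rw [diagWt]; abel

theorem symbol_comm_sub_poisson_mem (hE : 0 < diagWt φ) {P Q : Weyl K} {α β : Γ}
    (hP : Weyl.symbol P ∈ degLE φ α) (hQ : Weyl.symbol Q ∈ degLE φ β) :
    Weyl.symbol (P * Q - Q * P) - poisson (Weyl.symbol P) (Weyl.symbol Q) ∈
      degLE φ (α + β - (2 : ℕ) • diagWt φ) := by
  have h1 := symbol_mul_sub_mul_add_mem hE hP hQ
  have h2 := symbol_mul_sub_mul_add_mem hE hQ hP
  rw [add_comm β α] at h2
  convert sub_mem h1 h2 using 1
  rw [map_sub, poisson]; ring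

end Filtration

/-! ### Leading monomials and their behaviour under products and commutators. -/

section Top

set_option linter.unusedSectionVars false

variable {K : Type*} [Field K]
variable {Γ : Type*} [AddCommGroup Γ] [LinearOrder Γ] [IsOrderedAddMonoid Γ]
variable {φ : (Fin 2 →₀ ℕ) →+ Γ}

/-- `c x^u` is the term of largest weight of `P`, and all the other terms have smaller weight. -/
def HasTop (φ : (Fin 2 →₀ ℕ) →+ Γ) (P : Weyl K) (u : Fin 2 →₀ ℕ) (c : K) : Prop :=
  c ≠ 0 ∧ ∃ γ < φ u, Weyl.symbol P - monomial u c ∈ degLE φ γ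

theorem HasTop.symbol_mem {P : Weyl K} {u : Fin 2 →₀ ℕ} {c : K} (h : HasTop φ P u c) :
    Weyl.symbol P ∈ degLE φ (φ u) := by
  obtain ⟨_, γ, hγ, h⟩ := h
  simpa using add_mem (degLE_mono hγ.le h) (monomial_mem_degLE (c := c) (le_refl (φ u)))

theorem HasTop.coeff_eq {P : Weyl K} {u : Fin 2 →₀ ℕ} {c : K} (h : HasTop φ P u c) :
    (Weyl.symbol P).coeff u = c := by
  obtain ⟨_, γ, hγ, h⟩ := h
  by_contra hne
  refine hγ.not_ge (mem_degLE.1 h u ?_)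
  simpa [sub_ne_zero] using hne

theorem HasTop.coeff_ne {P : Weyl K} {u : Fin 2 →₀ ℕ} {c : K} (h : HasTop φ P u c) :
    (Weyl.symbol P).coeff u ≠ 0 := h.coeff_eq ▸ h.1

theorem HasTop.le {P : Weyl K} {u : Fin 2 →₀ ℕ} {c : K} (h : HasTop φ P u c)
    {s : Fin 2 →₀ ℕ} (hs : (Weyl.symbol P).coeff s ≠ 0) : φ s ≤ φ u :=
  mem_degLE.1 h.symbol_mem s hs

theorem HasTop.le_of_mem {P : Weyl K} {u : Fin 2 →₀ ℕ} {c : K} (h : HasTop φ P u c)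
    {γ : Γ} (hs : Weyl.symbol P ∈ degLE φ γ) : φ u ≤ γ :=
  mem_degLE.1 hs u h.coeff_ne

theorem HasTop.unique (hφ : Function.Injective φ) {P : Weyl K} {u v : Fin 2 →₀ ℕ} {c e : K}
    (h : HasTop φ P u c) (h' : HasTop φ P v e) : u = v :=
  hφ (le_antisymm (h'.le h.coeff_ne) (h.le h'.coeff_ne))

theorem exists_lt_mem_degLE (hE : 0 < diagWt φ) {p : Poly2 K} {γ : Γ}
    (h : ∀ s, p.coeff s ≠ 0 → φ s < γ) : ∃ γ' < γ, p ∈ degLE φ γ' := by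
  by_cases hp : p.support.Nonempty
  · obtain ⟨t, ht, hm⟩ := p.support.exists_max_image φ hp
    exact ⟨φ t, h t (mem_support_iff.1 ht), mem_degLE.2 fun s hs => hm s (mem_support_iff.2 hs)⟩
  -- The zero polynomial satisfies every bound; any value below γ serves.
  · refine ⟨γ - diagWt φ, sub_lt_self _ hE, ?_⟩
    rw [Finset.not_nonempty_iff_eq_empty, support_eq_empty] at hp
    simp [hp]

theorem hasTop_of_forall_le (hφ : Function.Injective φ) (hE : 0 < diagWt φ) {P : Weyl K}
    {u : Fin 2 →₀ ℕ} (hu : (Weyl.symbol P).coeff u ≠ 0)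
    (h : ∀ s, (Weyl.symbol P).coeff s ≠ 0 → φ s ≤ φ u) :
    HasTop φ P u ((Weyl.symbol P).coeff u) := by
  refine ⟨hu, exists_lt_mem_degLE hE fun s hs => ?_⟩
  rw [coeff_sub, coeff_monomial] at hs
  split_ifs at hs with hsu
  · subst hsu; simp at hs
  · rw [sub_zero] at hs
    exact (h s hs).lt_of_ne fun h => hsu (hφ h).symm

theorem exists_hasTop (hφ : Function.Injective φ) (hE : 0 < diagWt φ) {P : Weyl K} (hP : P ≠ 0) :
    ∃ u c, HasTop φ P u c := by
  have hp : (Weyl.symbol P).support.Nonempty := by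
    rw [Finset.nonempty_iff_ne_empty, Ne, support_eq_empty]
    exact (map_ne_zero_iff _ Weyl.symbol_bijective.1).2 hP
  obtain ⟨u, hu, hm⟩ := (Weyl.symbol P).support.exists_max_image φ hp
  exact ⟨u, _, hasTop_of_forall_le hφ hE (mem_support_iff.1 hu) fun s hs =>
    hm s (mem_support_iff.2 hs)⟩

theorem hasTop_zero_of_symbol_eq_C {P : Weyl K} (hE : 0 < diagWt φ) {c : K} (hc : c ≠ 0)
    (h : Weyl.symbol P = C c) :
    HasTop φ P 0 c :=
  ⟨hc, -diagWt φ, by simpa using hE, by simp [h]⟩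

theorem HasTop.mul (hE : 0 < diagWt φ) {P Q : Weyl K} {u v : Fin 2 →₀ ℕ} {c e : K}
    (hP : HasTop φ P u c) (hQ : HasTop φ Q v e) : HasTop φ (P * Q) (u + v) (c * e) := by
  refine ⟨mul_ne_zero hP.1 hQ.1, ?_⟩
  have h := symbol_mul_sub_mul_mem hE hP.symbol_mem hQ.symbol_mem
  have hP' := hP.symbol_mem
  obtain ⟨-, γ, hγ, h1⟩ := hP
  obtain ⟨-, δ, hδ, h2⟩ := hQ
  have h3 := mul_mem_degLE hP' h2
  have h4 := mul_mem_degLE h1 (monomial_mem_degLE (c := e) (le_refl (φ v)))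
  set m := max (φ u + φ v - diagWt φ) (max (φ u + δ) (γ + φ v)) with hm
  refine ⟨m, ?_, ?_⟩
  · rw [map_add]
    exact max_lt (sub_lt_self _ hE) (max_lt (by gcongr) (by gcongr))
  · convert add_mem (degLE_mono (by simp [hm] : _ ≤ m) h)
      (add_mem (degLE_mono (by simp [hm] : _ ≤ m) h3) (degLE_mono (by simp [hm] : _ ≤ m) h4)) using 1
    have : (monomial (u + v) (c * e) : Poly2 K) = monomial u c * monomial v e := by
      rw [monomial_mul]
    rw [this]
    ring

theorem HasTop.pow (hE : 0 < diagWt φ) {P : Weyl K} {u : Fin 2 →₀ ℕ} {c : K}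
    (hP : HasTop φ P u c) (n : ℕ) : HasTop φ (P ^ n) (n • u) (c ^ n) := by
  induction n with
  | zero =>
    rw [pow_zero, zero_smul, pow_zero]
    exact hasTop_zero_of_symbol_eq_C hE one_ne_zero (by simp [Weyl.symbol_one])
  | succ n ih =>
    rw [pow_succ, pow_succ, add_smul, one_smul]
    exact ih.mul hE hP

theorem HasTop.smul {P : Weyl K} {u : Fin 2 →₀ ℕ} {c a : K} (hP : HasTop φ P u c) (ha : a ≠ 0) :
    HasTop φ (a • P) u (a * c) := by
  obtain ⟨hc, γ, hγ, h⟩ := hP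
  refine ⟨mul_ne_zero ha hc, γ, hγ, ?_⟩
  convert Submodule.smul_mem _ a h using 1
  rw [map_smul, smul_sub, smul_monomial, smul_eq_mul]

theorem HasTop.add {P Q : Weyl K} {u : Fin 2 →₀ ℕ} {c e : K} (hP : HasTop φ P u c)
    (hQ : HasTop φ Q u e) (h : c + e ≠ 0) : HasTop φ (P + Q) u (c + e) := by
  obtain ⟨hc, γ, hγ, h1⟩ := hP
  obtain ⟨he, δ, hδ, h2⟩ := hQ
  refine ⟨h, max γ δ, max_lt hγ hδ, ?_⟩
  convert add_mem (degLE_mono (le_max_left γ δ) h1) (degLE_mono (le_max_right γ δ) h2) using 1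
  rw [map_add, map_add]; ring

theorem HasTop.exists_sub_mem {P Q : Weyl K} {u : Fin 2 →₀ ℕ} {c : K} (hP : HasTop φ P u c)
    (hQ : HasTop φ Q u c) : ∃ γ < φ u, Weyl.symbol (P - Q) ∈ degLE φ γ := by
  obtain ⟨hc, γ, hγ, h1⟩ := hP
  obtain ⟨he, δ, hδ, h2⟩ := hQ
  refine ⟨max γ δ, max_lt hγ hδ, ?_⟩
  convert sub_mem (degLE_mono (le_max_left γ δ) h1) (degLE_mono (le_max_right γ δ) h2) using 1
  rw [map_sub]; ring

/-- The determinant `u₁ v₀ - v₁ u₀`, the coefficient of the Poisson bracket of two monomials. -/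
def crossDet (u v : Fin 2 →₀ ℕ) : ℤ := u 1 * v 0 - v 1 * u 0

theorem coeff_poisson_monomial (u v w : Fin 2 →₀ ℕ) (c e : K) :
    (poisson (monomial u c) (monomial v e)).coeff w =
      if w + Finsupp.single 0 1 + Finsupp.single 1 1 = u + v then (crossDet u v : K) * (c * e)
      else 0 := by
  have aux : ∀ (u v : Fin 2 →₀ ℕ) (c e : K),
      (pderiv 1 (monomial u c) * pderiv 0 (monomial v e)).coeff w =
        if w + Finsupp.single 0 1 + Finsupp.single 1 1 = u + v then
          (u 1 : K) * (v 0) * (c * e) else 0 := by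
    intro u v c e
    rw [pderiv_monomial, pderiv_monomial, monomial_mul, coeff_monomial]
    -- Exponents are truncated at 0 by differentiation; when truncation occurs the coefficient
    -- vanishes anyway.
    by_cases hu : u 1 = 0
    · simp [hu]
    by_cases hv : v 0 = 0
    · simp [hv]
    have : u - Finsupp.single 1 1 + (v - Finsupp.single 0 1) = w ↔
        w + Finsupp.single 0 1 + Finsupp.single 1 1 = u + v := by
      simp only [Finsupp.ext_iff, Fin.forall_fin_two, Finsupp.add_apply, Finsupp.tsub_apply,
        Finsupp.single_apply]
      simp
      omega
    simp only [this]
    split_ifs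
    · ring
    · rfl
  rw [poisson, coeff_sub, aux, aux, add_comm v u]
  split_ifs
  · rw [crossDet]; push_cast; ring
  · simp

theorem HasTop.symbol_comm_sub (hE : 0 < diagWt φ) {P Q : Weyl K}
    {u v : Fin 2 →₀ ℕ} {c e : K} (hP : HasTop φ P u c) (hQ : HasTop φ Q v e) :
    ∃ γ < φ u + φ v - diagWt φ, Weyl.symbol (P * Q - Q * P) -
      poisson (monomial u c) (monomial v e) ∈ degLE φ γ := by
  have h := symbol_comm_sub_poisson_mem hE hP.symbol_mem hQ.symbol_mem
  have hP' := hP.symbol_mem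
  obtain ⟨-, γ, hγ, h1⟩ := hP
  obtain ⟨-, δ, hδ, h2⟩ := hQ
  have h3 := poisson_mem_degLE hP' h2
  have h4 := poisson_mem_degLE h1 (monomial_mem_degLE (c := e) (le_refl (φ v)))
  set m := max (φ u + φ v - (2 : ℕ) • diagWt φ)
    (max (φ u + δ - diagWt φ) (γ + φ v - diagWt φ)) with hm
  refine ⟨m, ?_, ?_⟩
  · refine max_lt ?_ (max_lt (by gcongr) (by gcongr))
    rw [two_smul, ← sub_sub]
    exact sub_lt_self _ hE
  · convert add_mem (degLE_mono (by simp [hm] : _ ≤ m) h)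
      (add_mem (degLE_mono (by simp [hm] : _ ≤ m) h3) (degLE_mono (by simp [hm] : _ ≤ m) h4)) using 1
    simp only [poisson, map_sub]
    ring

theorem HasTop.comm_of_crossDet_eq_zero (hE : 0 < diagWt φ) {P Q : Weyl K}
    {u v : Fin 2 →₀ ℕ} {c e : K} (hP : HasTop φ P u c) (hQ : HasTop φ Q v e)
    (h : crossDet u v = 0) :
    ∃ γ < φ u + φ v - diagWt φ, Weyl.symbol (P * Q - Q * P) ∈ degLE φ γ := by
  obtain ⟨γ, hγ, hm⟩ := hP.symbol_comm_sub hE hQ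
  refine ⟨γ, hγ, ?_⟩
  have : poisson (monomial u c) (monomial v e) = 0 := by
    ext w; rw [coeff_poisson_monomial]; simp [h]
  simpa [this] using hm

theorem HasTop.comm_of_crossDet_ne_zero [CharZero K] (hE : 0 < diagWt φ) {P Q : Weyl K}
    {u v : Fin 2 →₀ ℕ} {c e : K} (hP : HasTop φ P u c) (hQ : HasTop φ Q v e)
    (h : crossDet u v ≠ 0) :
    ∃ w, w + Finsupp.single 0 1 + Finsupp.single 1 1 = u + v ∧
      HasTop φ (P * Q - Q * P) w (crossDet u v * (c * e)) := by
  -- A nonzero determinant makes both coordinates of u + v positive, so the truncated subtractions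
  -- are exact.
  have hw : u + v - Finsupp.single 0 1 - Finsupp.single 1 1 + Finsupp.single 0 1 +
      Finsupp.single 1 1 = u + v := by
    have h0 : u 0 + v 0 ≠ 0 := fun h0 => h (by simp [crossDet, (by omega : u 0 = 0),
      (by omega : v 0 = 0)])
    have h1 : u 1 + v 1 ≠ 0 := fun h0 => h (by simp [crossDet, (by omega : u 1 = 0),
      (by omega : v 1 = 0)])
    simp only [Finsupp.ext_iff, Fin.forall_fin_two, Finsupp.add_apply, Finsupp.tsub_apply,
        Finsupp.single_apply]
    simp
    omega
  set w := u + v - Finsupp.single 0 1 - Finsupp.single 1 1 with hwdef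
  refine ⟨w, hw, ?_, ?_⟩
  · exact mul_ne_zero (by exact_mod_cast h) (mul_ne_zero hP.1 hQ.1)
  obtain ⟨γ, hγ, hm⟩ := hP.symbol_comm_sub hE hQ
  refine ⟨γ, ?_, ?_⟩
  · have := congrArg φ hw
    simp only [map_add] at this
    rwa [diagWt, ← this, add_assoc, add_sub_cancel_right] at hγ
  · convert hm using 2
    ext t
    rw [coeff_monomial, coeff_poisson_monomial, ← hw]
    have : t + Finsupp.single 0 1 + Finsupp.single 1 1 =
      w + Finsupp.single 0 1 + Finsupp.single 1 1 ↔ w = t := by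
      rw [add_left_inj, add_left_inj, eq_comm]
    simp only [this]

end Top

/-! ### Leading monomials of a pair with [Q, P] = 1. -/

section Commutator

set_option linter.unusedSectionVars false

variable {K : Type*} [Field K] [CharZero K]
variable {Γ : Type*} [AddCommGroup Γ] [LinearOrder Γ] [IsOrderedAddMonoid Γ]
variable {φ : (Fin 2 →₀ ℕ) →+ Γ}

theorem map_eq_nsmul_diagWt {u : Fin 2 →₀ ℕ} (h : u 0 = u 1) : φ u = u 0 • diagWt φ := by
  rw [diagWt, smul_add, ← map_nsmul, ← map_nsmul, ← map_add]
  congr 1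
  ext k; fin_cases k <;> simp [h]

theorem crossDet_eq_zero_of_diag {u v : Fin 2 →₀ ℕ} (hu : u 0 = u 1) (hv : v 0 = v 1) :
    crossDet u v = 0 := by
  rw [crossDet, hu, hv]; ring

theorem commutator_pow_succ (P R : Weyl K) (n : ℕ) :
    P * R ^ (n + 1) - R ^ (n + 1) * P =
      (P * R ^ n - R ^ n * P) * R + R ^ n * (P * R - R * P) := by
  rw [pow_succ]; simp only [sub_mul, mul_sub, mul_assoc]; abel

/-- By the Leibniz rule the leading term is a sum of n + 1 equal terms, which cannot cancel in
characteristic 0. -/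
theorem HasTop.comm_pow (hE : 0 < diagWt φ) {P R : Weyl K} {v w : Fin 2 →₀ ℕ} {e κ : K}
    (hR : HasTop φ R v e) (hS : HasTop φ (P * R - R * P) w κ) (n : ℕ) :
    HasTop φ (P * R ^ (n + 1) - R ^ (n + 1) * P) (n • v + w) ((n + 1) * (e ^ n * κ)) := by
  induction n with
  | zero => simpa using hS
  | succ n ih =>
    rw [commutator_pow_succ]
    have h1 := ih.mul hE hR
    have h2 := (hR.pow hE (n + 1)).mul hE hS
    have hp : n • v + w + v = (n + 1) • v + w := by rw [add_smul, one_smul]; abel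
    rw [hp] at h1
    have hc : ((n : K) + 1) * (e ^ n * κ) * e + e ^ (n + 1) * κ =
        ((n + 1 : ℕ) + 1) * (e ^ (n + 1) * κ) := by
      push_cast; ring
    rw [← hc]
    refine h1.add h2 ?_
    rw [hc]
    exact mul_ne_zero (by exact_mod_cast Nat.succ_ne_zero (n + 1))
      (mul_ne_zero (pow_ne_zero _ hR.1) hS.1)

/-- Either v is parallel to the diagonal vector u, or u + v - (1,1) = w; both put v on the diagonal.
The leading Poisson bracket then vanishes, whence the strict inequality. -/
theorem HasTop.diag_of_comm (hφ : Function.Injective φ) (hE : 0 < diagWt φ)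
    {P R : Weyl K} {u v w : Fin 2 →₀ ℕ} {c e κ : K} (hP : HasTop φ P u c) (hu : u 0 = u 1)
    (hu0 : u 0 ≠ 0) (hR : HasTop φ R v e) (hS : HasTop φ (P * R - R * P) w κ) (hw : w 0 = w 1) :
    v 0 = v 1 ∧ w 0 + 1 < u 0 + v 0 := by
  have hv : v 0 = v 1 := by
    by_cases hd : crossDet u v = 0
    · rw [crossDet, ← hu, mul_comm, ← sub_mul] at hd
      have : (v 0 : ℤ) - v 1 = 0 := by
        rcases mul_eq_zero.1 (by linear_combination hd : ((v 0 : ℤ) - v 1) * u 0 = 0) with h | h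
        · exact h
        · exact absurd (by exact_mod_cast h) hu0
      omega
    · obtain ⟨w', hw', h⟩ := hP.comm_of_crossDet_ne_zero hE hR hd
      obtain rfl := h.unique hφ hS
      have h0 := DFunLike.congr_fun hw' 0
      have h1 := DFunLike.congr_fun hw' 1
      simp at h0 h1
      omega
  refine ⟨hv, ?_⟩
  obtain ⟨γ, hγ, h⟩ := hP.comm_of_crossDet_eq_zero hE hR (crossDet_eq_zero_of_diag hu hv)
  have h := (hS.le_of_mem h).trans_lt hγ
  rw [map_eq_nsmul_diagWt hw, map_eq_nsmul_diagWt hu, map_eq_nsmul_diagWt hv,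
    lt_sub_iff_add_lt, ← add_smul, ← succ_nsmul] at h
  exact (nsmul_left_strictMono hE).lt_iff_lt.1 h

/-- Induction on a bound n for the gap `u 0 + v 0 - w 0 - 1`, which `diag_of_comm` shows to be
positive. -/
theorem HasTop.false_of_diag (hφ : Function.Injective φ) (hE : 0 < diagWt φ)
    {P : Weyl K} {u : Fin 2 →₀ ℕ} {c : K} (hP : HasTop φ P u c) (hu : u 0 = u 1)
    (hu0 : u 0 ≠ 0) (n : ℕ) : ∀ (R : Weyl K) (v w : Fin 2 →₀ ℕ) (e κ : K), HasTop φ R v e →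
      HasTop φ (P * R - R * P) w κ → w 0 = w 1 → u 0 + v 0 ≤ n + w 0 + 1 → False := by
  induction n with
  | zero =>
    intro R v w e κ hR hS hw hn
    have := (hP.diag_of_comm hφ hE hu hu0 hR hS hw).2
    omega
  | succ n ih =>
    intro R v w e κ hR hS hw hn
    obtain ⟨hv, hlt⟩ := hP.diag_of_comm hφ hE hu hu0 hR hS hw
    obtain ⟨i, hi⟩ := Nat.exists_eq_succ_of_ne_zero hu0
    -- This scalar makes R^(u₀) and a P^(v₀) share their leading term. The difference has the same
    -- commutator with P as R^(u₀), but a smaller leading exponent, so the gap drops.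
    set a : K := e ^ (i + 1) / c ^ v 0 with ha
    have ha0 : a ≠ 0 := div_ne_zero (pow_ne_zero _ hR.1) (pow_ne_zero _ hP.1)
    have h1 := hR.pow hE (i + 1)
    have h2 := (hP.pow hE (v 0)).smul ha0
    have hpt : v 0 • u = (i + 1) • v := by
      ext k; fin_cases k
      · simp [hi, mul_comm]
      · simp [← hu, ← hv, hi, mul_comm]
    rw [hpt, ha, div_mul_cancel₀ _ (pow_ne_zero _ hP.1), ← ha] at h2
    obtain ⟨γ, hγ, hmem⟩ := h1.exists_sub_mem h2
    have h3 := hR.comm_pow hE hS i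
    have hcomm : P * R ^ (i + 1) - R ^ (i + 1) * P =
        P * (R ^ (i + 1) - a • P ^ v 0) - (R ^ (i + 1) - a • P ^ v 0) * P := by
      rw [mul_sub, sub_mul, mul_smul_comm, smul_mul_assoc, ← pow_succ, ← pow_succ']
      abel
    rw [hcomm] at h3
    have hne : R ^ (i + 1) - a • P ^ v 0 ≠ 0 := by
      intro h0
      rw [h0] at h3
      exact h3.coeff_ne (by simp)
    obtain ⟨v', e', hR'⟩ := exists_hasTop hφ hE hne
    have hw' : (i • v + w) 0 = (i • v + w) 1 := by simp [hv, hw]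
    obtain ⟨hv', -⟩ := hP.diag_of_comm hφ hE hu hu0 hR' h3 hw'
    refine ih _ v' _ e' _ hR' h3 hw' ?_
    have hlt' := (hR'.le_of_mem hmem).trans_lt hγ
    have hiv : ((i + 1) • v) 0 = ((i + 1) • v) 1 := by simp [hv]
    rw [map_eq_nsmul_diagWt hv', map_eq_nsmul_diagWt hiv] at hlt'
    have hlt2 := (nsmul_left_strictMono hE).lt_iff_lt.1 hlt'
    simp only [Finsupp.add_apply, Finsupp.smul_apply, smul_eq_mul] at hlt2 ⊢
    rw [add_mul, one_mul] at hlt2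
    omega

theorem hasTop_comm {P Q : Weyl K} (hE : 0 < diagWt φ) (h : Q * P - P * Q = 1) :
    HasTop φ (P * Q - Q * P) 0 (-1) := by
  refine hasTop_zero_of_symbol_eq_C hE (neg_ne_zero.2 one_ne_zero) ?_
  rw [← neg_sub, h, map_neg, Weyl.symbol_one, C_neg, C_1]

theorem ne_zero_left_of_comm {P Q : Weyl K} (h : Q * P - P * Q = 1) : P ≠ 0 := by
  rintro rfl
  have := congrArg Weyl.symbol h
  simp [Weyl.symbol_one] at this

theorem ne_zero_right_of_comm {P Q : Weyl K} (h : Q * P - P * Q = 1) : Q ≠ 0 := by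
  rintro rfl
  have := congrArg Weyl.symbol h
  simp [Weyl.symbol_one] at this

/-- If `[Q, P] = 1`, then no leading monomial of `P` is a power of `xy` other than `1`. -/
theorem HasTop.ne_diag (hφ : Function.Injective φ) (hE : 0 < diagWt φ)
    {P Q : Weyl K} (h : Q * P - P * Q = 1) {u : Fin 2 →₀ ℕ} {c : K} (hP : HasTop φ P u c)
    (hu0 : u 0 ≠ 0) : u 0 ≠ u 1 := by
  intro hu
  obtain ⟨v, e, hQ⟩ := exists_hasTop hφ hE (ne_zero_right_of_comm h)
  exact hP.false_of_diag hφ hE hu hu0 (u 0 + v 0) Q v 0 e _ hQ (hasTop_comm hE h) rfl (by simp)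

/-- The commutator has weight at most `φ u + φ v - diagWt φ`, and the constant -1 has weight 0. -/
theorem HasTop.diagWt_le (hE : 0 < diagWt φ) {P Q : Weyl K} (h : Q * P - P * Q = 1)
    {u v : Fin 2 →₀ ℕ} {c e : K} (hP : HasTop φ P u c) (hQ : HasTop φ Q v e) :
    diagWt φ ≤ φ u + φ v := by
  have h0 := hasTop_comm hE h
  have := symbol_comm_sub_poisson_mem hE hP.symbol_mem hQ.symbol_mem
  have h2 := add_mem (degLE_mono (β := φ u + φ v - diagWt φ) ?_ this)
    (poisson_mem_degLE hP.symbol_mem hQ.symbol_mem)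
  · rw [sub_add_cancel] at h2
    have := h0.le_of_mem h2
    rwa [map_zero, sub_nonneg] at this
  · rw [two_smul, ← sub_sub]; exact sub_le_self _ hE.le

theorem HasTop.crossDet_eq_zero (hφ : Function.Injective φ) (hE : 0 < diagWt φ)
    {P Q : Weyl K} (h : Q * P - P * Q = 1) {u v : Fin 2 →₀ ℕ} {c e : K}
    (hP : HasTop φ P u c) (hQ : HasTop φ Q v e)
    (hne : u + v ≠ Finsupp.single 0 1 + Finsupp.single 1 1) : crossDet u v = 0 := by
  by_contra hd
  obtain ⟨w, hw, h1⟩ := hP.comm_of_crossDet_ne_zero hE hQ hd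
  obtain rfl := h1.unique hφ (hasTop_comm hE h)
  exact hne (by rw [← hw, zero_add])

end Commutator

/-! ### Lexicographic weights attached to directions. -/

/-- The weight comparing first `v_d` and then `v_e`. -/
noncomputable def lexWt (d e : ℤ × ℤ) : (Fin 2 →₀ ℕ) →+ ℤ ×ₗ ℤ where
  toFun s := toLex (vPt d (expPt s), vPt e (expPt s))
  map_zero' := by simp [vPt, expPt]
  map_add' s t := by
    rw [← toLex_add, Prod.mk_add_mk]
    congr 2 <;> simp only [vPt, expPt, Finsupp.add_apply] <;> push_cast <;> ring

theorem lexWt_apply (d e : ℤ × ℤ) (s : Fin 2 →₀ ℕ) :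
    lexWt d e s = toLex (vPt d (expPt s), vPt e (expPt s)) := rfl

theorem vPt_expPt (d : ℤ × ℤ) (s : Fin 2 →₀ ℕ) : vPt d (expPt s) = d.1 * s 0 + d.2 * s 1 := rfl

theorem lexWt_le {d e : ℤ × ℤ} {s t : Fin 2 →₀ ℕ} :
    lexWt d e s ≤ lexWt d e t ↔ vPt d (expPt s) < vPt d (expPt t) ∨
      vPt d (expPt s) = vPt d (expPt t) ∧ vPt e (expPt s) ≤ vPt e (expPt t) :=
  Prod.Lex.toLex_le_toLex

theorem lexWt_injective {d e : ℤ × ℤ} (h : d.1 * e.2 - d.2 * e.1 ≠ 0) :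
    Function.Injective (lexWt d e) := by
  intro s t hst
  rw [lexWt_apply, lexWt_apply, toLex_inj, Prod.mk.injEq] at hst
  simp only [vPt_expPt] at hst
  obtain ⟨h1, h2⟩ := hst
  have h0 : ((s 0 : ℤ) - t 0) = 0 := by
    refine (mul_eq_zero.1 (?_ : (d.1 * e.2 - d.2 * e.1) * ((s 0 : ℤ) - t 0) = 0)).resolve_left h
    linear_combination e.2 * h1 - d.2 * h2
  have h3 : ((s 1 : ℤ) - t 1) = 0 := by
    refine (mul_eq_zero.1 (?_ : (d.1 * e.2 - d.2 * e.1) * ((s 1 : ℤ) - t 1) = 0)).resolve_left h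
    linear_combination d.1 * h2 - e.1 * h1
  ext k; fin_cases k
  · simp; omega
  · simp; omega

theorem diagWt_lexWt (d e : ℤ × ℤ) : diagWt (lexWt d e) = toLex (d.1 + d.2, e.1 + e.2) := by
  rw [diagWt, lexWt_apply, lexWt_apply, ← toLex_add, Prod.mk_add_mk]
  simp [vPt_expPt]

theorem diagWt_lexWt_pos {d : ℤ × ℤ} (e : ℤ × ℤ) (h : 0 < d.1 + d.2) :
    0 < diagWt (lexWt d e) := by
  rw [diagWt_lexWt, ← toLex_zero, Prod.Lex.toLex_lt_toLex]
  exact Or.inl h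

/-! ### Degrees, leading terms, starting and end points in terms of `HasTop`. -/

section Translate

variable {K : Type*} [Field K]

theorem HasTop.vPt_le {P : Weyl K} {d e : ℤ × ℤ} {u : Fin 2 →₀ ℕ} {c : K}
    (h : HasTop (lexWt d e) P u c) {s : Fin 2 →₀ ℕ} (hs : (Weyl.symbol P).coeff s ≠ 0) :
    vPt d (expPt s) ≤ vPt d (expPt u) := by
  rcases lexWt_le.1 (h.le hs) with h | h
  · exact h.le
  · exact h.1.le

theorem HasTop.vPt_snd_le {P : Weyl K} {d e : ℤ × ℤ} {u : Fin 2 →₀ ℕ} {c : K}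
    (h : HasTop (lexWt d e) P u c) {s : Fin 2 →₀ ℕ} (hs : (Weyl.symbol P).coeff s ≠ 0)
    (hd : vPt d (expPt s) = vPt d (expPt u)) :
    vPt e (expPt s) ≤ vPt e (expPt u) := by
  rcases lexWt_le.1 (h.le hs) with h | h
  · exact absurd hd h.ne
  · exact h.2

theorem vBot_eq {p : Poly2 K} {d : ℤ × ℤ} {u : Fin 2 →₀ ℕ} (hu : p.coeff u ≠ 0)
    (h : ∀ s, p.coeff s ≠ 0 → vPt d (expPt s) ≤ vPt d (expPt u)) :
    vBot d p = (vPt d (expPt u) : ℤ) := by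
  refine le_antisymm (Finset.sup_le fun s hs => ?_) ?_
  · exact_mod_cast h s (mem_support_iff.1 hs)
  · exact Finset.le_sup (f := fun s => (vPt d (expPt s) : WithBot ℤ)) (mem_support_iff.2 hu)

theorem vInt_eq {p : Poly2 K} {d : ℤ × ℤ} {u : Fin 2 →₀ ℕ} (hu : p.coeff u ≠ 0)
    (h : ∀ s, p.coeff s ≠ 0 → vPt d (expPt s) ≤ vPt d (expPt u)) :
    vInt d p = vPt d (expPt u) := by
  rw [vInt, vBot_eq hu h]; rfl

theorem coeff_lead {p : Poly2 K} {d : ℤ × ℤ} {u : Fin 2 →₀ ℕ} (hu : p.coeff u ≠ 0)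
    (h : ∀ s, p.coeff s ≠ 0 → vPt d (expPt s) ≤ vPt d (expPt u)) (s : Fin 2 →₀ ℕ) :
    (lead d p).coeff s = if vPt d (expPt s) = vPt d (expPt u) then p.coeff s else 0 := by
  classical
  rw [lead, coeff_sum]
  simp only [coeff_monomial, vBot_eq hu h, WithBot.coe_inj]
  rw [Finset.sum_ite_eq']
  simp only [Finset.mem_filter, mem_support_iff]
  by_cases h0 : p.coeff s = 0 <;> simp [h0]

theorem expPt_injective : Function.Injective expPt := by
  intro s t h
  simp only [expPt, Prod.mk.injEq, Nat.cast_inj] at h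
  ext k; fin_cases k
  · exact h.1
  · exact h.2

theorem mem_supp {p : Poly2 K} {s : Fin 2 →₀ ℕ} : expPt s ∈ supp p ↔ p.coeff s ≠ 0 := by
  rw [supp, Finset.mem_image]
  constructor
  · rintro ⟨t, ht, h⟩
    rw [← expPt_injective h]
    exact mem_support_iff.1 ht
  · intro h
    exact ⟨s, mem_support_iff.2 h, rfl⟩

theorem mem_supp_iff {p : Poly2 K} {a : ℤ × ℤ} :
    a ∈ supp p ↔ ∃ s, expPt s = a ∧ p.coeff s ≠ 0 := by
  constructor
  · intro h
    obtain ⟨s, hs, rfl⟩ := Finset.mem_image.1 h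
    exact ⟨s, rfl, mem_support_iff.1 hs⟩
  · rintro ⟨s, rfl, h⟩
    exact mem_supp.2 h

theorem HasTop.deg_eq {P : Weyl K} {d e : ℤ × ℤ} {u : Fin 2 →₀ ℕ} {c : K}
    (h : HasTop (lexWt d e) P u c) : Weyl.deg d P = vPt d (expPt u) :=
  vInt_eq h.coeff_ne fun _ hs => h.vPt_le hs

theorem HasTop.vBot_eq {P : Weyl K} {d e : ℤ × ℤ} {u : Fin 2 →₀ ℕ} {c : K}
    (h : HasTop (lexWt d e) P u c) : vBot d (Weyl.symbol P) = (vPt d (expPt u) : ℤ) :=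
  Dixmier.vBot_eq h.coeff_ne fun _ hs => h.vPt_le hs

theorem HasTop.coeff_ell {P : Weyl K} {d e : ℤ × ℤ} {u : Fin 2 →₀ ℕ} {c : K}
    (h : HasTop (lexWt d e) P u c) (s : Fin 2 →₀ ℕ) : (Weyl.ell d P).coeff s =
      if vPt d (expPt s) = vPt d (expPt u) then (Weyl.symbol P).coeff s else 0 :=
  coeff_lead h.coeff_ne (fun _ hs => h.vPt_le hs) s

theorem HasTop.coeff_lead_ell_ne_zero_iff {P : Weyl K} {d e : ℤ × ℤ} (hd : d.1 * e.2 - d.2 * e.1 ≠ 0)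
    {u : Fin 2 →₀ ℕ} {c : K} (h : HasTop (lexWt d e) P u c) (s : Fin 2 →₀ ℕ) :
    (lead e (Weyl.ell d P)).coeff s ≠ 0 ↔ s = u := by
  have hu : (Weyl.ell d P).coeff u ≠ 0 := by rw [h.coeff_ell, if_pos rfl]; exact h.coeff_ne
  have hm : ∀ s, (Weyl.ell d P).coeff s ≠ 0 → vPt e (expPt s) ≤ vPt e (expPt u) := by
    intro s hs
    rw [h.coeff_ell] at hs
    split_ifs at hs with h1
    · exact h.vPt_snd_le hs h1
    · exact absurd rfl hs
  rw [coeff_lead hu hm]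
  constructor
  · intro hs
    split_ifs at hs with h2
    · rw [h.coeff_ell] at hs
      split_ifs at hs with h1
      · refine lexWt_injective hd ?_
        rw [lexWt_apply, lexWt_apply, h1, h2]
      · exact absurd rfl hs
    · exact absurd rfl hs
  · rintro rfl
    rwa [if_pos rfl]

theorem HasTop.vInt_ell {P : Weyl K} {d e : ℤ × ℤ}
    {u : Fin 2 →₀ ℕ} {c : K} (h : HasTop (lexWt d e) P u c) :
    vInt e (Weyl.ell d P) = vPt e (expPt u) := by
  refine vInt_eq ?_ fun s hs => ?_
  · rw [h.coeff_ell, if_pos rfl]; exact h.coeff_ne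
  · rw [h.coeff_ell] at hs
    split_ifs at hs with h1
    · exact h.vPt_snd_le hs h1
    · exact absurd rfl hs

theorem HasTop.st_eq {P : Weyl K} {d : ℤ × ℤ} (hd : 0 < d.1 + d.2)
    {u : Fin 2 →₀ ℕ} {c : K} (h : HasTop (lexWt d (1, -1)) P u c) :
    Weyl.st d P = expPt u := by
  have hset : {i : ℤ | (i, i - vPt (1, -1) (expPt u)) ∈ supp (lead (1, -1) (Weyl.ell d P))} =
      {(u 0 : ℤ)} := by
    ext i
    rw [Set.mem_ofPred_eq, mem_supp_iff]
    simp only [h.coeff_lead_ell_ne_zero_iff (by simp; omega), exists_eq_right,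
      Set.mem_singleton_iff, vPt, expPt, Prod.mk.injEq]
    constructor
    · rintro ⟨h, -⟩; exact h.symm
    · rintro rfl; exact ⟨rfl, by ring⟩
  simp only [Weyl.st, wPt, h.vInt_ell, hset, csSup_singleton]
  simp [vPt, expPt]

theorem HasTop.en_eq {P : Weyl K} {d : ℤ × ℤ} (hd : 0 < d.1 + d.2)
    {u : Fin 2 →₀ ℕ} {c : K} (h : HasTop (lexWt d (-1, 1)) P u c) :
    Weyl.en d P = expPt u := by
  have hset : {i : ℤ | (i - vPt (-1, 1) (expPt u), i) ∈ supp (lead (-1, 1) (Weyl.ell d P))} =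
      {(u 1 : ℤ)} := by
    ext i
    rw [Set.mem_ofPred_eq, mem_supp_iff]
    simp only [h.coeff_lead_ell_ne_zero_iff (by simp; omega), exists_eq_right,
      Set.mem_singleton_iff, vPt, expPt, Prod.mk.injEq]
    constructor
    · rintro ⟨-, h⟩; exact h.symm
    · rintro rfl; exact ⟨by ring, rfl⟩
  simp only [Weyl.en, wbarPt, h.vInt_ell, hset, csSup_singleton]
  simp [vPt, expPt]

theorem HasTop.mem_Dir {P : Weyl K} {d e : ℤ × ℤ} (hd : d ∈ directions)
    {u s : Fin 2 →₀ ℕ} {c : K} (h : HasTop (lexWt d e) P u c) (hs : (Weyl.symbol P).coeff s ≠ 0)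
    (hv : vPt d (expPt s) = vPt d (expPt u)) (hne : s ≠ u) : d ∈ Weyl.Dir P := by
  refine ⟨hd, Finset.one_lt_card.2 ⟨expPt s, mem_supp.2 ?_, expPt u, mem_supp.2 ?_,
    fun h => hne (expPt_injective h)⟩⟩
  · rw [h.coeff_ell, if_pos hv]; exact hs
  · rw [h.coeff_ell, if_pos rfl]; exact h.coeff_ne

end Translate

/-! ### Propagating the ratio of the starting points from one direction to another. -/

section Walk

variable {K : Type*} [Field K] [CharZero K]

theorem HasTop.add_le_vPt {P Q : Weyl K} (h : Q * P - P * Q = 1) {d e : ℤ × ℤ}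
    (hd : 0 < d.1 + d.2) {u v : Fin 2 →₀ ℕ} {a b : K} (hP : HasTop (lexWt d e) P u a)
    (hQ : HasTop (lexWt d e) Q v b) :
    d.1 + d.2 < vPt d (expPt u) + vPt d (expPt v) ∨
      d.1 + d.2 = vPt d (expPt u) + vPt d (expPt v) ∧
        e.1 + e.2 ≤ vPt e (expPt u) + vPt e (expPt v) := by
  have := hP.diagWt_le (diagWt_lexWt_pos e hd) h hQ
  rwa [diagWt_lexWt, lexWt_apply, lexWt_apply, ← toLex_add, Prod.mk_add_mk,
    Prod.Lex.toLex_le_toLex] at this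

/-- The two degrees have the same sign and their sum is at least ρ + σ > 0. -/
theorem HasTop.vPt_pos {P Q : Weyl K} (h : Q * P - P * Q = 1) {n m : ℤ} (hn : 0 < n) (hm : 0 < m)
    {d e : ℤ × ℤ} (hd : 0 < d.1 + d.2) {u v : Fin 2 →₀ ℕ} {a b : K}
    (hP : HasTop (lexWt d e) P u a) (hQ : HasTop (lexWt d e) Q v b)
    (hv : n * vPt d (expPt u) = m * vPt d (expPt v)) :
    0 < vPt d (expPt u) ∧ 0 < vPt d (expPt v) := by
  have hsum : d.1 + d.2 ≤ vPt d (expPt u) + vPt d (expPt v) := by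
    rcases hP.add_le_vPt h hd hQ with h | h
    · exact h.le
    · exact h.1.le
  have : 0 < vPt d (expPt u) := by
    by_contra hx
    have : 0 < vPt d (expPt v) := by linarith
    have : 0 < m * vPt d (expPt v) := mul_pos hm this
    have : n * vPt d (expPt u) ≤ 0 := mul_nonpos_of_nonneg_of_nonpos hn.le (not_lt.1 hx)
    linarith
  exact ⟨this, pos_of_mul_pos_right (hv ▸ mul_pos hn this) hm.le⟩

theorem proportional_of_crossDet_eq_zero {n m : ℤ} {d : ℤ × ℤ} {u v : Fin 2 →₀ ℕ}
    (hx : 0 < vPt d (expPt u)) (hdet : crossDet u v = 0)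
    (hv : n * vPt d (expPt u) = m * vPt d (expPt v)) :
    n * u 0 = m * v 0 ∧ n * u 1 = m * v 1 := by
  rw [vPt_expPt, vPt_expPt] at hv
  rw [vPt_expPt] at hx
  rw [crossDet] at hdet
  constructor
  · refine sub_eq_zero.1 ((mul_eq_zero.1 (?_ : (d.1 * u 0 + d.2 * u 1) *
      (n * u 0 - m * v 0 : ℤ) = 0)).resolve_left hx.ne')
    linear_combination (u 0 : ℤ) * hv - d.2 * m * hdet
  · refine sub_eq_zero.1 ((mul_eq_zero.1 (?_ : (d.1 * u 0 + d.2 * u 1) *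
      (n * u 1 - m * v 1 : ℤ) = 0)).resolve_left hx.ne')
    linear_combination (u 1 : ℤ) * hv + d.1 * m * hdet

theorem HasTop.proportional {P Q : Weyl K} (h : Q * P - P * Q = 1) {n m : ℤ} (hn : 0 < n)
    (hm : 0 < m) {d : ℤ × ℤ} (hd : 0 < d.1 + d.2) (hσ : d.2 ≤ 0) {u v : Fin 2 →₀ ℕ} {a b : K}
    (hP : HasTop (lexWt d (1, -1)) P u a) (hQ : HasTop (lexWt d (1, -1)) Q v b)
    (hv : n * vPt d (expPt u) = m * vPt d (expPt v)) :
    n * u 0 = m * v 0 ∧ n * u 1 = m * v 1 := by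
  obtain ⟨hx, hy⟩ := hP.vPt_pos h hn hm hd hQ hv
  refine proportional_of_crossDet_eq_zero hx ?_ hv
  refine hP.crossDet_eq_zero (lexWt_injective (by simp; omega)) (diagWt_lexWt_pos _ hd) h hQ ?_
  -- If u + v = (1,1), then u or v is (0,0) or (0,1), where `v_d` is 0 or σ ≤ 0, against positivity.
  intro huv
  have h0 : u 0 + v 0 = 1 := by simpa using DFunLike.congr_fun huv 0
  have h1 : u 1 + v 1 = 1 := by simpa using DFunLike.congr_fun huv 1
  rw [vPt_expPt] at hx hy
  rcases Nat.eq_zero_or_pos (u 0) with hu0 | hu0 <;> rcases Nat.eq_zero_or_pos (u 1) with hu1 | hu1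
  · simp [hu0, hu1] at hx
  · have : u 1 = 1 := by omega
    simp [hu0, this] at hx; omega
  · have h2 : v 0 = 0 := by omega
    have h3 : v 1 = 1 := by omega
    simp [h2, h3] at hy; omega
  · have h2 : v 0 = 0 := by omega
    have h3 : v 1 = 0 := by omega
    simp [h2, h3] at hy

/-- Moving along an edge towards (1,-1) lowers the second coordinate; this makes the walk terminate.
-/
theorem snd_lt_of_vPt_eq {d : ℤ × ℤ} (hd : 0 < d.1 + d.2) (hσ : d.2 ≤ 0) {s t : Fin 2 →₀ ℕ}
    (h : vPt d (expPt s) = vPt d (expPt t))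
    (hlt : vPt (1, -1) (expPt t) < vPt (1, -1) (expPt s)) : s 1 < t 1 := by
  simp only [vPt_expPt] at h hlt
  by_contra hle
  have hle : (t 1 : ℤ) ≤ s 1 := by exact_mod_cast not_lt.1 hle
  have h1 : 0 < (d.1 + d.2) * ((s 0 : ℤ) - t 0) := mul_pos hd (by linarith)
  have h2 : 0 ≤ d.2 * (((s 1 : ℤ) - t 1) - (s 0 - t 0)) :=
    mul_nonneg_of_nonpos_of_nonpos hσ (by linarith)
  nlinarith

theorem vPt_add_smul (d e : ℤ × ℤ) (A B : ℤ) (s : ℤ × ℤ) :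
    vPt (B * d.1 + A * e.1, B * d.2 + A * e.2) s = B * vPt d s + A * vPt e s := by
  simp only [vPt]; ring

/-- Between `d` and `(1, -1)` the leading monomials of `P` and `Q` stay proportional. -/
theorem proportional_of_proportional {P Q : Weyl K} (h : Q * P - P * Q = 1) {n m : ℤ}
    (hn : 0 < n) (hm : 0 < m) {d₀ : ℤ × ℤ} (hd₀ : 0 < d₀.1 + d₀.2) (hσ₀ : d₀.2 ≤ 0) (k : ℕ) :
    ∀ (d : ℤ × ℤ) (u v : Fin 2 →₀ ℕ) (a b : K), 0 < d.1 + d.2 → d.2 ≤ 0 →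
      0 ≤ d₀.1 * d.2 - d₀.2 * d.1 → HasTop (lexWt d (1, -1)) P u a →
      HasTop (lexWt d (1, -1)) Q v b → n * u 0 = m * v 0 → n * u 1 = m * v 1 → u 1 = k →
      ∀ (u' v' : Fin 2 →₀ ℕ) (a' b' : K), HasTop (lexWt d₀ (1, -1)) P u' a' →
        HasTop (lexWt d₀ (1, -1)) Q v' b' → n * u' 0 = m * v' 0 ∧ n * u' 1 = m * v' 1 := by
  induction k using Nat.strong_induction_on with
  | _ k ih =>
  intro d u v a b hd hσ hδ hP hQ h0 h1 hk u' v' a' b' hP' hQ'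
  have step : ∀ d₁ : ℤ × ℤ, 0 < d₁.1 + d₁.2 → d₁.2 ≤ 0 →
      (∀ s, (Weyl.symbol P).coeff s ≠ 0 → vPt d₁ (expPt s) ≤ vPt d₁ (expPt u)) →
      (∀ s, (Weyl.symbol Q).coeff s ≠ 0 → vPt d₁ (expPt s) ≤ vPt d₁ (expPt v)) →
      ∀ u₁ v₁ a₁ b₁, HasTop (lexWt d₁ (1, -1)) P u₁ a₁ → HasTop (lexWt d₁ (1, -1)) Q v₁ b₁ →
      (vPt d₁ (expPt u₁) = vPt d₁ (expPt u) ∧ vPt d₁ (expPt v₁) = vPt d₁ (expPt v)) ∧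
      n * u₁ 0 = m * v₁ 0 ∧ n * u₁ 1 = m * v₁ 1 := by
    intro d₁ hd₁ hσ₁ hmP hmQ u₁ v₁ a₁ b₁ hP₁ hQ₁
    have e1 := le_antisymm (hmP _ hP₁.coeff_ne) (hP₁.vPt_le hP.coeff_ne)
    have e2 := le_antisymm (hmQ _ hQ₁.coeff_ne) (hQ₁.vPt_le hQ.coeff_ne)
    refine ⟨⟨e1, e2⟩, hP₁.proportional h hn hm hd₁ hσ₁ hQ₁ ?_⟩
    rw [e1, e2, vPt_expPt, vPt_expPt]
    linear_combination d₁.1 * h0 + d₁.2 * h1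
  -- Each pair records the loss in `v_d` and the gain in `v_{d₀}` when the current vertex is
  -- replaced by s.
  set T : Finset (ℤ × ℤ) :=
    ((Weyl.symbol P).support.image fun s => (vPt d (expPt u) - vPt d (expPt s),
      vPt d₀ (expPt s) - vPt d₀ (expPt u))) ∪
    ((Weyl.symbol Q).support.image fun s => (vPt d (expPt v) - vPt d (expPt s),
      vPt d₀ (expPt s) - vPt d₀ (expPt v))) with hT
  have hTP : ∀ s, (Weyl.symbol P).coeff s ≠ 0 → (vPt d (expPt u) - vPt d (expPt s),
      vPt d₀ (expPt s) - vPt d₀ (expPt u)) ∈ T := fun s hs =>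
    Finset.mem_union_left _ (Finset.mem_image_of_mem (fun s => (vPt d (expPt u) - vPt d (expPt s),
      vPt d₀ (expPt s) - vPt d₀ (expPt u))) (mem_support_iff.2 hs))
  have hTQ : ∀ s, (Weyl.symbol Q).coeff s ≠ 0 → (vPt d (expPt v) - vPt d (expPt s),
      vPt d₀ (expPt s) - vPt d₀ (expPt v)) ∈ T := fun s hs =>
    Finset.mem_union_right _ (Finset.mem_image_of_mem (fun s => (vPt d (expPt v) - vPt d (expPt s),
      vPt d₀ (expPt s) - vPt d₀ (expPt v))) (mem_support_iff.2 hs))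
  have hT1 : ∀ p ∈ T, 0 ≤ p.1 := by
    intro p hp
    rcases Finset.mem_union.1 hp with hp | hp <;> obtain ⟨s, hs, rfl⟩ := Finset.mem_image.1 hp
    · exact sub_nonneg.2 (hP.vPt_le (mem_support_iff.1 hs))
    · exact sub_nonneg.2 (hQ.vPt_le (mem_support_iff.1 hs))
  by_cases hne : (T.filter fun p => 0 < p.2).Nonempty
  -- The smallest ratio A/B of loss to gain finds the first direction B d + A d₀ on the way to d₀ in
  -- which a vertex of P or Q is tied. The old vertices are still maximal there. The direction need
  -- not be primitive.
  · obtain ⟨⟨A, B⟩, hABT, hmin⟩ :=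
      (T.filter fun p => 0 < p.2).exists_min_image (fun p => (p.1 : ℚ) / p.2) hne
    obtain ⟨hAB, hB⟩ := Finset.mem_filter.1 hABT
    have hA : 0 ≤ A := hT1 _ hAB
    change 0 < B at hB
    have hle : ∀ p ∈ T, A * p.2 ≤ B * p.1 := by
      intro p hp
      by_cases hp2 : 0 < p.2
      · have := hmin p (Finset.mem_filter.2 ⟨hp, hp2⟩)
        rw [div_le_div_iff₀ (by exact_mod_cast hB) (by exact_mod_cast hp2)] at this
        have : A * p.2 ≤ p.1 * B := by exact_mod_cast this
        linarith
      · exact (mul_nonpos_of_nonneg_of_nonpos hA (not_lt.1 hp2)).trans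
          (mul_nonneg hB.le (hT1 p hp))
    set d₁ : ℤ × ℤ := (B * d.1 + A * d₀.1, B * d.2 + A * d₀.2) with hd₁def
    have hd₁ : 0 < d₁.1 + d₁.2 := by
      have e1 := mul_pos hB hd
      have e2 := mul_nonneg hA hd₀.le
      simp only [hd₁def]; linarith
    have hσ₁ : d₁.2 ≤ 0 := add_nonpos (mul_nonpos_of_nonneg_of_nonpos hB.le hσ)
      (mul_nonpos_of_nonneg_of_nonpos hA hσ₀)
    have hδ₁ : 0 ≤ d₀.1 * d₁.2 - d₀.2 * d₁.1 := by
      have := mul_nonneg hB.le hδ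
      simp only [hd₁def]; linarith
    have hv₁ : ∀ s, vPt d₁ s = B * vPt d s + A * vPt d₀ s := vPt_add_smul d d₀ A B
    have hφ : Function.Injective (lexWt d₁ (1, -1)) := lexWt_injective (by simp; omega)
    have hE := diagWt_lexWt_pos (1, -1) hd₁
    obtain ⟨u₁, a₁, hP₁⟩ := exists_hasTop hφ hE (ne_zero_left_of_comm h)
    obtain ⟨v₁, b₁, hQ₁⟩ := exists_hasTop hφ hE (ne_zero_right_of_comm h)
    obtain ⟨⟨e1, e2⟩, h0', h1'⟩ := step d₁ hd₁ hσ₁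
      (fun s hs => by have := hle _ (hTP s hs); rw [hv₁, hv₁]; linarith)
      (fun s hs => by have := hle _ (hTQ s hs); rw [hv₁, hv₁]; linarith) u₁ v₁ a₁ b₁ hP₁ hQ₁
    have drop : ∀ (R : Weyl K) (t t₁ : Fin 2 →₀ ℕ) (r : K), HasTop (lexWt d₁ (1, -1)) R t₁ r →
        vPt d₁ (expPt t₁) = vPt d₁ (expPt t) →
        (A, B) ∈ ((Weyl.symbol R).support.image fun s => (vPt d (expPt t) - vPt d (expPt s),
          vPt d₀ (expPt s) - vPt d₀ (expPt t))) → t₁ 1 < t 1 := by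
      intro R t t₁ r hR ht hmem
      obtain ⟨s, hs, hs'⟩ := Finset.mem_image.1 hmem
      rw [Prod.mk.injEq] at hs'
      obtain ⟨hsA, hsB⟩ := hs'
      have tie : vPt d₁ (expPt s) = vPt d₁ (expPt t) := by
        rw [hv₁, hv₁]; linear_combination (-B) * hsA + A * hsB
      refine snd_lt_of_vPt_eq hd₁ hσ₁ ht (lt_of_lt_of_le ?_
        (hR.vPt_snd_le (mem_support_iff.1 hs) (tie.trans ht.symm)))
      -- The left side is positive, so the tied point s lies strictly further towards (1,-1) than t.
      have key : (d₁.1 + d₁.2) * B = (d₀.1 * d₁.2 - d₀.2 * d₁.1) *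
          (vPt (1, -1) (expPt s) - vPt (1, -1) (expPt t)) := by
        rw [← hsB]
        simp only [vPt_expPt] at tie ⊢
        linear_combination (d₀.1 + d₀.2) * tie
      exact sub_pos.1 (pos_of_mul_pos_right (key ▸ mul_pos hd₁ hB) hδ₁)
    have hlt : u₁ 1 < k := by
      rw [← hk]
      rcases Finset.mem_union.1 hAB with hm' | hm'
      · exact drop P u u₁ a₁ hP₁ e1 hm'
      -- A drop of the vertex of Q transfers to P through the common ratio.
      · have := drop Q v v₁ b₁ hQ₁ e2 hm'
        have h3 : n * (u₁ 1 : ℤ) < n * u 1 := by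
          rw [h1, h1']
          exact mul_lt_mul_of_pos_left (by exact_mod_cast this) hm
        exact_mod_cast lt_of_mul_lt_mul_left h3 hn.le
    exact ih _ hlt d₁ u₁ v₁ a₁ b₁ hd₁ hσ₁ hδ₁ hP₁ hQ₁ h0' h1' rfl u' v' a' b' hP' hQ'
  -- Without any gain the current vertices are already maximal for d₀.
  · have hle : ∀ p ∈ T, p.2 ≤ 0 := fun p hp => by
      by_contra hp2
      exact hne ⟨p, Finset.mem_filter.2 ⟨hp, not_le.1 hp2⟩⟩
    exact (step d₀ hd₀ hσ₀ (fun s hs => sub_nonpos.1 (hle _ (hTP s hs)))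
      (fun s hs => sub_nonpos.1 (hle _ (hTQ s hs))) u' v' a' b' hP' hQ').2

end Walk

/-! ### Automorphisms acting on counterexamples, and the use of minimality. -/

section Minimal

variable {K : Type*} [Field K]

/-- The homomorphism from the Weyl algebra with given values on the generators. -/
noncomputable def Weyl.lift (P Q : Weyl K) (h : Q * P - P * Q = 1) : Weyl K →ₐ[K] Weyl K :=
  RingQuot.liftAlgHom K ⟨FreeAlgebra.lift K ![P, Q], by
    intro a b hab
    cases hab
    simpa using h⟩

theorem Weyl.lift_X (P Q : Weyl K) (h : Q * P - P * Q = 1) :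
    Weyl.lift P Q h (Weyl.X K) = P := by
  simp [Weyl.lift, Weyl.X]

theorem Weyl.lift_Y (P Q : Weyl K) (h : Q * P - P * Q = 1) :
    Weyl.lift P Q h (Weyl.Y K) = Q := by
  simp [Weyl.lift, Weyl.Y]

theorem Weyl.algHom_ext {f g : Weyl K →ₐ[K] Weyl K} (hX : f (Weyl.X K) = g (Weyl.X K))
    (hY : f (Weyl.Y K) = g (Weyl.Y K)) : f = g := by
  refine RingQuot.ringQuot_ext' K _ _ (FreeAlgebra.hom_ext (funext fun i => ?_))
  fin_cases i
  · exact hX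
  · exact hY

theorem Weyl.comm_Y_X : Weyl.Y K * Weyl.X K - Weyl.X K * Weyl.Y K = 1 := by
  rw [Weyl.Y_mul_X, add_sub_cancel_left]

theorem comm_neg_left {R : Type*} [Ring R] (x y : R) (h : y * x - x * y = 1) :
    -x * y - y * -x = 1 := by
  rw [← h, neg_mul, mul_neg]; abel

theorem comm_neg_right {R : Type*} [Ring R] (x y : R) (h : y * x - x * y = 1) :
    x * -y - -y * x = 1 := by
  rw [← h, neg_mul, mul_neg]; abel

namespace Weyl

theorem IsCounterexample.comm {P Q : Weyl K} (h : IsCounterexample P Q) :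
    Q * P - P * Q = 1 := by
  obtain ⟨φ, rfl, rfl, -⟩ := h
  rw [← map_mul, ← map_mul, ← map_sub, comm_Y_X, map_one]

theorem IsCounterexample.swap {P Q : Weyl K} (h : IsCounterexample P Q) :
    IsCounterexample Q (-P) := by
  obtain ⟨φ, rfl, rfl, hb⟩ := h
  have h1 : -X K * Y K - Y K * -X K = 1 := comm_neg_left _ _ comm_Y_X
  have h2 : X K * -Y K - -Y K * X K = 1 := comm_neg_right _ _ comm_Y_X
  have hτ : Function.Bijective (lift (Y K) (-X K) h1) := by
    refine Function.bijective_iff_has_inverse.2 ⟨lift (-Y K) (X K) h2, fun a => ?_, fun a => ?_⟩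
    · refine AlgHom.congr_fun (φ₁ := (lift (-Y K) (X K) h2).comp (lift (Y K) (-X K) h1))
        (φ₂ := AlgHom.id K _) (algHom_ext ?_ ?_) a <;> simp [lift_X, lift_Y]
    · refine AlgHom.congr_fun (φ₁ := (lift (Y K) (-X K) h1).comp (lift (-Y K) (X K) h2))
        (φ₂ := AlgHom.id K _) (algHom_ext ?_ ?_) a <;> simp [lift_X, lift_Y]
  refine ⟨φ.comp (lift (Y K) (-X K) h1), by simp [lift_X], by simp [lift_Y], fun hb' => hb ?_⟩
  rw [AlgHom.coe_comp] at hb'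
  exact (Function.Bijective.of_comp_iff _ hτ).1 hb'

/-- Precompose with the automorphism fixing X and sending Y to Y - aX^k. -/
theorem IsCounterexample.sub_smul_pow {P Q : Weyl K} (h : IsCounterexample P Q) (a : K) (k : ℕ) :
    IsCounterexample P (Q - a • P ^ k) := by
  obtain ⟨φ, rfl, rfl, hb⟩ := h
  have h1 : ∀ a : K, (Y K - a • X K ^ k) * X K - X K * (Y K - a • X K ^ k) = 1 := by
    intro a
    rw [← comm_Y_X, sub_mul, mul_sub, smul_mul_assoc, mul_smul_comm, ← pow_succ, ← pow_succ']
    abel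
  have h2 : ∀ a b : K, a + b = 0 → Function.LeftInverse (lift _ _ (h1 a)) (lift _ _ (h1 b)) := by
    intro a b hab c
    refine AlgHom.congr_fun (φ₁ := (lift _ _ (h1 a)).comp (lift _ _ (h1 b)))
        (φ₂ := AlgHom.id K _) (algHom_ext ?_ ?_) c
    · simp [lift_X]
    · simp [lift_X, lift_Y, sub_sub, ← add_smul, hab]
  have hτ : Function.Bijective (lift _ _ (h1 a)) :=
    Function.bijective_iff_has_inverse.2 ⟨lift _ _ (h1 (-a)), h2 _ _ (by simp), h2 _ _ (by simp)⟩
  refine ⟨φ.comp (lift _ _ (h1 a)), by simp [lift_X], by simp [lift_Y], fun hb' => hb ?_⟩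
  rw [AlgHom.coe_comp] at hb'
  exact (Function.Bijective.of_comp_iff _ hτ).1 hb'

theorem minGcd_le {P Q : Weyl K} (h : IsCounterexample P Q) :
    minGcd K ≤ ((Int.gcd (deg (1, 1) P) (deg (1, 1) Q) : ℕ) : ℕ∞) :=
  iInf_le_of_le P (iInf_le_of_le Q (iInf_le _ h))

theorem deg_neg (d : ℤ × ℤ) (P : Weyl K) : deg d (-P) = deg d P := by
  simp [deg, vInt, vBot, support_neg]

theorem IsMinimalPair.swap {P Q : Weyl K} (h : IsMinimalPair P Q) : IsMinimalPair Q (-P) :=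
  ⟨h.1.swap, by rw [h.2, deg_neg, Int.gcd_comm]⟩

end Weyl

open Weyl

variable [CharZero K]

theorem HasTop.nsmul_of_deg_eq {P R : Weyl K} (h : R * P - P * R = 1) {u : Fin 2 →₀ ℕ} {c : K}
    (hP : HasTop (lexWt (1, 1) (1, -1)) P u c) (h0 : 0 < u 0) (h1 : 0 < u 1) {k : ℕ}
    (hdeg : deg (1, 1) R = k * deg (1, 1) P) :
    ∃ e, HasTop (lexWt (1, 1) (1, -1)) R (k • u) e := by
  have hφ : Function.Injective (lexWt (1, 1) (1, -1)) := lexWt_injective (by simp)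
  have hE := diagWt_lexWt_pos (d := (1, 1)) (1, -1) (by simp)
  obtain ⟨v, e, hR⟩ := exists_hasTop hφ hE (ne_zero_right_of_comm h)
  have hdet : crossDet u v = 0 := by
    by_cases huv : u + v = Finsupp.single 0 1 + Finsupp.single 1 1
    · have e0 : u 0 + v 0 = 1 := by simpa using DFunLike.congr_fun huv 0
      have e1 : u 1 + v 1 = 1 := by simpa using DFunLike.congr_fun huv 1
      simp [crossDet, (by omega : v 0 = 0), (by omega : v 1 = 0)]
    · exact hP.crossDet_eq_zero hφ hE h hR huv
  rw [hP.deg_eq, hR.deg_eq] at hdeg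
  have hx : 0 < vPt (1, 1) (expPt u) := by
    simp only [vPt_expPt, one_mul]; omega
  obtain ⟨e0, e1⟩ := proportional_of_crossDet_eq_zero (n := k) (m := 1) hx hdet (by linarith)
  refine ⟨e, ?_⟩
  convert hR using 1
  ext i
  fin_cases i
  · simp only [Fin.zero_eta, Finsupp.smul_apply, smul_eq_mul]; rw [one_mul] at e0; exact_mod_cast e0
  · simp only [Fin.mk_one, Finsupp.smul_apply, smul_eq_mul]; rw [one_mul] at e1; exact_mod_cast e1

/-- Descent on k: the leading monomial of R is that of P^k, and subtracting a multiple of P^k gives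
another counterexample, whose degree is again a multiple j of that of P, with j < k. -/
theorem deg_ne_mul_of_forall_dvd {P : Weyl K} {u : Fin 2 →₀ ℕ} {c : K}
    (hP : HasTop (lexWt (1, 1) (1, -1)) P u c) (h0 : 0 < u 0) (h1 : 0 < u 1)
    (hdvd : ∀ R, IsCounterexample P R → deg (1, 1) P ∣ deg (1, 1) R) (k : ℕ) :
    ∀ R, IsCounterexample P R → deg (1, 1) R ≠ k * deg (1, 1) P := by
  induction k using Nat.strong_induction_on with
  | _ k ih =>
  intro R hR hdeg
  have hE := diagWt_lexWt_pos (d := (1, 1)) (1, -1) (by simp)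
  have hx : 0 < deg (1, 1) P := by
    rw [hP.deg_eq]; simp only [vPt_expPt, one_mul]; omega
  obtain ⟨e, hRt⟩ := hP.nsmul_of_deg_eq hR.comm h0 h1 hdeg
  have ha : e / c ^ k ≠ 0 := div_ne_zero hRt.1 (pow_ne_zero _ hP.1)
  have hPt := (hP.pow hE k).smul ha
  rw [div_mul_cancel₀ _ (pow_ne_zero _ hP.1)] at hPt
  obtain ⟨γ, hγ, hmem⟩ := hRt.exists_sub_mem hPt
  have hR' := hR.sub_smul_pow (e / c ^ k) k
  set R' := R - (e / c ^ k) • P ^ k with hR'def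
  have hnn : 0 ≤ deg (1, 1) R' := by
    obtain ⟨v, b, hv⟩ := exists_hasTop (lexWt_injective (by simp)) hE
      (ne_zero_right_of_comm hR'.comm)
    rw [hv.deg_eq]; simp only [vPt_expPt, one_mul]; omega
  obtain ⟨j, hj⟩ := hdvd R' hR'
  have hj0 : 0 ≤ j := nonneg_of_mul_nonneg_right (hj ▸ hnn) hx
  lift j to ℕ using hj0
  rw [mul_comm] at hj
  obtain ⟨b, hb⟩ := hP.nsmul_of_deg_eq hR'.comm h0 h1 hj
  have hlt := (hb.le_of_mem hmem).trans_lt hγ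
  rw [map_nsmul, map_nsmul] at hlt
  have hpos : 0 < lexWt (1, 1) (1, -1) u := by
    rw [lexWt_apply, ← toLex_zero, Prod.Lex.toLex_lt_toLex]
    left
    rw [← hP.deg_eq]; exact hx
  exact ih j ((nsmul_left_strictMono hpos).lt_iff_lt.1 hlt) R' hR' hj

theorem Weyl.IsMinimalPair.deg_ne_mul {P Q : Weyl K} (h : IsMinimalPair P Q) {u : Fin 2 →₀ ℕ}
    {c : K} (hP : HasTop (lexWt (1, 1) (1, -1)) P u c) (h0 : 0 < u 0) (h1 : 0 < u 1) (k : ℕ) :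
    deg (1, 1) Q ≠ k * deg (1, 1) P := by
  intro hk
  have hx : 0 < deg (1, 1) P := by
    rw [hP.deg_eq]; simp only [vPt_expPt, one_mul]; omega
  refine deg_ne_mul_of_forall_dvd hP h0 h1 (fun R hR => ?_) k Q h.1 hk
  -- Here B is the degree of P, so no gcd with that degree can be smaller; hence divisibility.
  have hle := minGcd_le hR
  rw [h.2, hk, Int.gcd_mul_left_right] at hle
  have hle : (deg (1, 1) P).natAbs ≤ Int.gcd (deg (1, 1) P) (deg (1, 1) R) := by
    exact_mod_cast hle
  have hdvd := Int.gcd_dvd_natAbs_left (deg (1, 1) P) (deg (1, 1) R)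
  have heq := le_antisymm (Nat.le_of_dvd (Int.natAbs_pos.2 hx.ne') hdvd) hle
  have := Int.gcd_dvd_right (deg (1, 1) P) (deg (1, 1) R)
  rw [heq] at this
  exact Int.natAbs_dvd.1 this

end Minimal

/-- A finite set with points on both sides of the diagonal has an edge crossing it. -/
theorem exists_crossing_edge (S : Finset (Fin 2 →₀ ℕ)) {u₀ w₀ : Fin 2 →₀ ℕ} (hu₀ : u₀ ∈ S)
    (hw₀ : w₀ ∈ S) (hu : u₀ 0 < u₀ 1) (hw : w₀ 1 ≤ w₀ 0) :
    ∃ u ∈ S, ∃ w ∈ S, u 0 < u 1 ∧ w 1 ≤ w 0 ∧ ∀ z ∈ S,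
      vPt ((u 1 : ℤ) - w 1, (w 0 : ℤ) - u 0) (expPt z) ≤
        vPt ((u 1 : ℤ) - w 1, (w 0 : ℤ) - u 0) (expPt w) := by
  -- Points are rescaled to (2i+1, 2j), so none lies on the diagonal and the original diagonal
  -- counts as below. The quotient is the coordinate at which the segment between the two points
  -- meets the diagonal; the outermost crossing is chosen.
  obtain ⟨⟨u, w⟩, hmem, hmax⟩ :=
    ((S.filter fun u => u 0 < u 1) ×ˢ (S.filter fun w => w 1 ≤ w 0)).exists_max_image
      (fun p => (((2 * p.2 0 + 1) * (2 * p.1 1) - 2 * p.2 1 * (2 * p.1 0 + 1) : ℤ) : ℚ) /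
        ((2 * p.1 1 - (2 * p.1 0 + 1) + ((2 * p.2 0 + 1) - 2 * p.2 1) : ℤ) : ℚ))
      ⟨(u₀, w₀), by simp [*]⟩
  simp only [Finset.mem_product, Finset.mem_filter] at hmem hmax
  obtain ⟨⟨huS, hu1⟩, hwS, hw1⟩ := hmem
  refine ⟨u, huS, w, hwS, hu1, hw1, fun z hz => ?_⟩
  have hmax' : ∀ a b : Fin 2 →₀ ℕ, a ∈ S → b ∈ S → a 0 < a 1 → b 1 ≤ b 0 →
      ((2 * b 0 + 1 : ℤ) * (2 * a 1) - 2 * b 1 * (2 * a 0 + 1)) *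
        (2 * u 1 - (2 * u 0 + 1) + ((2 * w 0 + 1) - 2 * w 1)) ≤
      ((2 * w 0 + 1 : ℤ) * (2 * u 1) - 2 * w 1 * (2 * u 0 + 1)) *
        (2 * a 1 - (2 * a 0 + 1) + ((2 * b 0 + 1) - 2 * b 1)) := by
    intro a b ha hb ha1 hb1
    have h := hmax (a, b) ⟨⟨ha, ha1⟩, hb, hb1⟩
    have h1 : (0 : ℤ) < 2 * a 1 - (2 * a 0 + 1) + ((2 * b 0 + 1) - 2 * b 1) := by omega
    have h2 : (0 : ℤ) < 2 * u 1 - (2 * u 0 + 1) + ((2 * w 0 + 1) - 2 * w 1) := by omega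
    rw [div_le_div_iff₀ (by exact_mod_cast h1) (by exact_mod_cast h2)] at h
    exact_mod_cast h
  simp only [vPt_expPt]
  -- Let z replace the endpoint on its own side. The cancelled factor measures the distance of the
  -- other endpoint from the shifted diagonal.
  rcases lt_or_ge (z 0) (z 1) with hz1 | hz1
  · have h := hmax' z w hz hwS hz1 hw1
    have h3 : (0 : ℤ) < 4 * ((2 * w 0 + 1) - 2 * w 1) := by omega
    refine le_of_mul_le_mul_left ?_ h3
    linarith
  · have h := hmax' u z huS hz hu1 hz1
    have h3 : (0 : ℤ) < 4 * (2 * u 1 - (2 * u 0 + 1)) := by omega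
    refine le_of_mul_le_mul_left ?_ h3
    linarith

/-! ### The crossing edge and the vanishing of the bracket. -/

section Main

variable {K : Type*} [Field K]

theorem Weyl.mem_support {P : Weyl K} {s : Fin 2 →₀ ℕ} :
    expPt s ∈ Weyl.support P ↔ (Weyl.symbol P).coeff s ≠ 0 := mem_supp

theorem Weyl.IsSubrectangular.exists_hasTop {P : Weyl K} (h : Weyl.IsSubrectangular P) :
    ∃ u c, 0 < u 0 ∧ 0 < u 1 ∧ (∀ s, (Weyl.symbol P).coeff s ≠ 0 → s 0 ≤ u 0 ∧ s 1 ≤ u 1) ∧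
      HasTop (lexWt (1, 1) (1, -1)) P u c := by
  obtain ⟨a, b, ha, hb, hab, hs⟩ := h
  obtain ⟨u, hu, hc⟩ := mem_supp_iff.1 hab
  simp only [expPt, Prod.mk.injEq, Nat.cast_inj] at hu
  obtain ⟨rfl, rfl⟩ := hu
  have hle : ∀ s, (Weyl.symbol P).coeff s ≠ 0 → s 0 ≤ u 0 ∧ s 1 ≤ u 1 := by
    intro s hs'
    obtain ⟨-, h1, -, h2⟩ := hs _ (Weyl.mem_support.2 hs')
    exact ⟨Int.ofNat_le.1 h1, Int.ofNat_le.1 h2⟩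
  refine ⟨u, _, ha, hb, hle, hasTop_of_forall_le (lexWt_injective (by simp))
    (diagWt_lexWt_pos _ (by simp)) hc fun s hs' => ?_⟩
  obtain ⟨h1, h2⟩ := hle s hs'
  rw [lexWt_le]
  simp only [vPt_expPt]
  omega

theorem exists_hasTop_right_edge {P : Weyl K} {u : Fin 2 →₀ ℕ}
    (hu : (Weyl.symbol P).coeff u ≠ 0) (hle : ∀ s, (Weyl.symbol P).coeff s ≠ 0 → s 0 ≤ u 0)
    (hst : vPt (1, -1) (Weyl.st (1, 0) P) < 0) :
    ∃ w c, HasTop (lexWt (1, 0) (1, -1)) P w c ∧ w 0 = u 0 ∧ w 0 < w 1 := by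
  have hP : P ≠ 0 := by
    rintro rfl
    simp at hu
  obtain ⟨w, c, hw⟩ := Dixmier.exists_hasTop (lexWt_injective (d := (1, 0)) (e := (1, -1)) (by simp))
    (diagWt_lexWt_pos _ (by simp)) hP
  rw [hw.st_eq (by simp), vPt_expPt] at hst
  have h1 := hw.vPt_le hu
  have h2 := hle w hw.coeff_ne
  simp only [vPt_expPt] at h1
  exact ⟨w, c, hw, by omega, by omega⟩

/-- The edge of the Newton polygon of `P` which crosses the diagonal below the corner, as the edge
in a direction of `𝔙` with negative second coordinate. -/
theorem exists_direction {P : Weyl K} {w₀ z₀ : Fin 2 →₀ ℕ} {c : K}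
    (hw₀ : HasTop (lexWt (1, 0) (1, -1)) P w₀ c) (hlt : w₀ 0 < w₀ 1)
    (hz₀ : (Weyl.symbol P).coeff z₀ ≠ 0) (hle : z₀ 1 ≤ z₀ 0) :
    ∃ d ∈ directions, d.2 < 0 ∧ ∃ u w : Fin 2 →₀ ℕ, (Weyl.symbol P).coeff u ≠ 0 ∧
      (Weyl.symbol P).coeff w ≠ 0 ∧ u 0 < u 1 ∧ w 1 ≤ w 0 ∧ vPt d (expPt u) = vPt d (expPt w) ∧
      ∀ z, (Weyl.symbol P).coeff z ≠ 0 → vPt d (expPt z) ≤ vPt d (expPt w) := by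
  obtain ⟨u, hu, w, hw, hu1, hw1, hmax⟩ := exists_crossing_edge _
    (mem_support_iff.2 hw₀.coeff_ne) (mem_support_iff.2 hz₀) hlt hle
  rw [mem_support_iff] at hu hw
  -- Otherwise σ ≥ 0, and the starting point w₀ of the right edge, which lies above the diagonal,
  -- would exceed the edge.
  have hneg : (w 0 : ℤ) - u 0 < 0 := by
    by_contra hge
    have h1 := hmax _ (mem_support_iff.2 hw₀.coeff_ne)
    have h2 := hw₀.vPt_le hw
    have h3 := hw₀.vPt_snd_le hw
    simp only [vPt_expPt] at h1 h2 h3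
    have hx : (0 : ℤ) < w₀ 0 - w 0 := by omega
    have hy : (0 : ℤ) < (w₀ 1 - w 1) - (w₀ 0 - w 0) := by omega
    have e1 : (0 : ℤ) < ((u 1 : ℤ) - u 0 + (w 0 - w 1)) * (w₀ 0 - w 0) :=
      mul_pos (by omega) hx
    have e2 : (0 : ℤ) ≤ ((w 0 : ℤ) - u 0) * ((w₀ 1 - w 1) - (w₀ 0 - w 0)) :=
      mul_nonneg (not_lt.1 hge) hy.le
    linarith
  obtain ⟨g, x, y, hg, hxy, ex, ey⟩ := Int.exists_gcd_one' (m := (u 1 : ℤ) - w 1)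
    (n := (w 0 : ℤ) - u 0) (Int.gcd_pos_of_ne_zero_right _ hneg.ne)
  have hg' : (0 : ℤ) < g := by exact_mod_cast hg
  have hv : ∀ s, vPt ((u 1 : ℤ) - w 1, (w 0 : ℤ) - u 0) s = g * vPt (x, y) s := by
    intro s
    simp only [vPt, ex, ey]; ring
  refine ⟨(x, y), ⟨hxy, ?_⟩, ?_, u, w, hu, hw, hu1, hw1, ?_, fun z hz => ?_⟩
  · refine pos_of_mul_pos_left (b := (g : ℤ)) ?_ hg'.le
    rw [add_mul, ← ex, ← ey]; omega
  · refine neg_of_mul_neg_left (b := (g : ℤ)) ?_ hg'.le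
    rw [← ey]; exact hneg
  · refine mul_left_cancel₀ hg'.ne' ?_
    rw [← hv, ← hv]
    simp only [vPt_expPt]; ring
  · refine le_of_mul_le_mul_left ?_ hg'
    rw [← hv, ← hv]
    exact hmax z (mem_support_iff.2 hz)

variable [CharZero K]

/-- In case of equality the tie-breaking weight and the common ratio put u on or below the diagonal.
Then `v_d` is at least ρ + σ at u and positive at v, a contradiction. -/
theorem HasTop.add_lt_vPt {P Q : Weyl K} (h : Q * P - P * Q = 1) {n m : ℤ} (hn : 0 < n)
    (hm : 0 < m) {d : ℤ × ℤ} (hd : 0 < d.1 + d.2) (hσ : d.2 ≤ 0) {u v : Fin 2 →₀ ℕ} {a b : K}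
    (hP : HasTop (lexWt d (1, -1)) P u a) (hQ : HasTop (lexWt d (1, -1)) Q v b)
    (h0 : n * u 0 = m * v 0) (h1 : n * u 1 = m * v 1) :
    d.1 + d.2 < vPt d (expPt u) + vPt d (expPt v) := by
  refine (hP.add_le_vPt h hd hQ).resolve_right ?_
  rintro ⟨heq, hle⟩
  obtain ⟨hx, hy⟩ := hP.vPt_pos h hn hm hd hQ
    (by rw [vPt_expPt, vPt_expPt]; linear_combination d.1 * h0 + d.2 * h1)
  simp only [vPt_expPt] at hle hx hy heq
  have hge : (u 1 : ℤ) ≤ u 0 := by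
    by_contra hlt
    have e1 : n * ((u 0 : ℤ) - u 1) < 0 := mul_neg_of_pos_of_neg hn (by omega)
    have e2 : m * ((v 0 : ℤ) - v 1) = n * ((u 0 : ℤ) - u 1) := by linear_combination h1 - h0
    have e3 : (v 0 : ℤ) - v 1 < 0 := by
      by_contra h4
      have := mul_nonneg hm.le (not_lt.1 h4)
      linarith
    omega
  have hpos : (1 : ℤ) ≤ u 0 := by
    by_contra h4
    have e0 : u 0 = 0 := by omega
    have e1 : u 1 = 0 := by omega
    simp [e0, e1] at hx
  nlinarith [mul_nonneg_of_nonpos_of_nonpos hσ (sub_nonpos.2 hge),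
    mul_nonneg hd.le (sub_nonneg.2 hpos)]

theorem bracket_eq_zero {P Q : Weyl K} (h : Q * P - P * Q = 1) {d e : ℤ × ℤ}
    (hd : 0 < d.1 + d.2) {u v : Fin 2 →₀ ℕ} {a b : K}
    (hP : HasTop (lexWt d e) P u a) (hQ : HasTop (lexWt d e) Q v b)
    (hlt : d.1 + d.2 < vPt d (expPt u) + vPt d (expPt v)) : Weyl.bracket d P Q = 0 := by
  rw [Weyl.bracket, if_pos]
  rw [Weyl.IsProportional, (hasTop_comm (diagWt_lexWt_pos e hd) h).vBot_eq, hP.vBot_eq, hQ.vBot_eq]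
  have h0 : vPt d (expPt 0) = 0 := by simp [vPt_expPt]
  rw [h0]
  exact_mod_cast (by simpa using hlt)

end Main

end Dixmier

/-! ### Assembly of the proposition. -/

theorem mainTheorem6 {K : Type*} [Field K] [CharZero K] [IsAlgClosed K]
    (P Q : Dixmier.Weyl K) (hPQ : Dixmier.Weyl.IsStandardMinimalPair P Q) :
    ∃ d : ℤ × ℤ, d ∈ Dixmier.Weyl.Dir P ∩ Dixmier.Weyl.Dir Q ∧
      d.2 < 0 ∧
      (0 < Dixmier.Weyl.deg d P ∧ 0 < Dixmier.Weyl.deg d Q) ∧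
      Dixmier.Weyl.bracket d P Q = 0 ∧
      (Dixmier.Weyl.deg d P : ℚ) / (Dixmier.Weyl.deg d Q : ℚ) =
        (Dixmier.Weyl.deg (1, 1) P : ℚ) / (Dixmier.Weyl.deg (1, 1) Q : ℚ) ∧
      ((∀ n : ℕ, (Dixmier.Weyl.deg d Q : ℚ) / (Dixmier.Weyl.deg d P : ℚ) ≠ n) ∧
        (∀ n : ℕ, (Dixmier.Weyl.deg d P : ℚ) / (Dixmier.Weyl.deg d Q : ℚ) ≠ n)) ∧
      (0 < Dixmier.vPt (1, -1) (Dixmier.Weyl.st d P) ∧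
        Dixmier.vPt (1, -1) (Dixmier.Weyl.en d P) < 0) := by
  open Dixmier in
  obtain ⟨hmin, hsP, hsQ, hstP, hstQ⟩ := hPQ
  have h := hmin.1.comm
  obtain ⟨p, cp, hp0, hp1, hpR, hpT⟩ := hsP.exists_hasTop
  obtain ⟨q, cq, hq0, hq1, hqR, hqT⟩ := hsQ.exists_hasTop
  obtain ⟨p', cp', hp'T, hp'0, hp'1⟩ := exists_hasTop_right_edge hpT.coeff_ne
    (fun s hs => (hpR s hs).1) hstP
  obtain ⟨q', cq', hq'T, hq'0, hq'1⟩ := exists_hasTop_right_edge hqT.coeff_ne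
    (fun s hs => (hqR s hs).1) hstQ
  have hinj : ∀ d : ℤ × ℤ, 0 < d.1 + d.2 → Function.Injective (lexWt d (1, -1)) :=
    fun d hd => lexWt_injective (by simp; omega)
  have hne : ∀ s t : Fin 2 →₀ ℕ, 2 ≤ s 0 + t 0 →
      s + t ≠ Finsupp.single 0 1 + Finsupp.single 1 1 := by
    intro s t hst heq
    have : s 0 + t 0 = 1 := by simpa using DFunLike.congr_fun heq 0
    omega
  have hdet := hpT.crossDet_eq_zero (hinj _ (by simp)) (diagWt_lexWt_pos _ (by simp)) h hqT
    (hne _ _ (by omega))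
  have hdet' := hp'T.crossDet_eq_zero (hinj _ (by simp)) (diagWt_lexWt_pos _ (by simp)) h hq'T
    (hne _ _ (by omega))
  have hm : 0 < Weyl.deg (1, 1) P := by
    rw [hpT.deg_eq]; simp only [vPt_expPt, one_mul]; omega
  have hn : 0 < Weyl.deg (1, 1) Q := by
    rw [hqT.deg_eq]; simp only [vPt_expPt, one_mul]; omega
  have hprop : Weyl.deg (1, 1) Q * p' 0 = Weyl.deg (1, 1) P * q' 0 ∧
      Weyl.deg (1, 1) Q * p' 1 = Weyl.deg (1, 1) P * q' 1 := by
    have e0 : Weyl.deg (1, 1) Q * p' 0 = Weyl.deg (1, 1) P * q' 0 := by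
      rw [hpT.deg_eq, hqT.deg_eq, hp'0, hq'0]
      rw [crossDet] at hdet
      simp only [vPt_expPt]
      linear_combination -hdet
    refine proportional_of_crossDet_eq_zero (d := (1, 0)) ?_ hdet' ?_
    · simp only [vPt_expPt]; omega
    · simp only [vPt_expPt]; linear_combination e0
  set m := Weyl.deg (1, 1) P with hmdef
  set n := Weyl.deg (1, 1) Q with hndef
  have hall : ∀ d : ℤ × ℤ, 0 < d.1 + d.2 → d.2 ≤ 0 → ∃ u v a b,
      HasTop (lexWt d (1, -1)) P u a ∧ HasTop (lexWt d (1, -1)) Q v b ∧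
      n * u 0 = m * v 0 ∧ n * u 1 = m * v 1 := by
    intro d hd hσ
    obtain ⟨u, a, hu⟩ := exists_hasTop (hinj d hd) (diagWt_lexWt_pos _ hd) (ne_zero_left_of_comm h)
    obtain ⟨v, b, hv⟩ := exists_hasTop (hinj d hd) (diagWt_lexWt_pos _ hd) (ne_zero_right_of_comm h)
    exact ⟨u, v, a, b, hu, hv, proportional_of_proportional h hn hm hd hσ (p' 1) (1, 0) p' q' cp' cq'
      (by simp) le_rfl (by simpa using hσ) hp'T hq'T hprop.1 hprop.2 rfl u v a b hu hv⟩
  have hvprop : ∀ (d : ℤ × ℤ) (u v : Fin 2 →₀ ℕ), n * u 0 = m * v 0 → n * u 1 = m * v 1 →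
      n * vPt d (expPt u) = m * vPt d (expPt v) := by
    intro d u v h0 h1
    rw [vPt_expPt, vPt_expPt]; linear_combination d.1 * h0 + d.2 * h1
  obtain ⟨z, hz, hz1⟩ : ∃ z, (Weyl.symbol P).coeff z ≠ 0 ∧ z 1 ≤ z 0 := by
    -- In this direction a point strictly above the diagonal with abscissa at most `p 0` has degree
    -- at most 0, so the starting point cannot be one.
    have hd : 0 < ((p 0 : ℤ) + 1) + -(p 0) := by omega
    obtain ⟨u, v, a, b, hu, hv, h0, h1⟩ := hall ((p 0 : ℤ) + 1, -(p 0)) hd (by simp)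
    refine ⟨u, hu.coeff_ne, ?_⟩
    obtain ⟨hx, -⟩ := hu.vPt_pos h hn hm hd hv (hvprop _ _ _ h0 h1)
    have hle := (hpR u hu.coeff_ne).1
    simp only [vPt_expPt] at hx
    by_contra hlt
    have : (p 0 : ℤ) * (u 0 + 1) ≤ p 0 * u 1 :=
      mul_le_mul_of_nonneg_left (by omega) (by omega)
    nlinarith
  obtain ⟨d, hdir, hσ, u, w, hu, hw, hu1, hw1, huw, hmax⟩ := exists_direction hp'T hp'1 hz hz1
  have hd : 0 < d.1 + d.2 := hdir.2
  obtain ⟨sP, sQ, a, b, hsP, hsQ, hs0, hs1⟩ := hall d hd hσ.le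
  have hinj' : Function.Injective (lexWt d (-1, 1)) := lexWt_injective (by simp; omega)
  have hE' := diagWt_lexWt_pos (-1, 1) hd
  obtain ⟨eP, a', heP⟩ := exists_hasTop hinj' hE' (ne_zero_left_of_comm h)
  obtain ⟨eQ, b', heQ⟩ := exists_hasTop hinj' hE' (ne_zero_right_of_comm h)
  have hvs := hvprop d sP sQ hs0 hs1
  obtain ⟨hx, hy⟩ := hsP.vPt_pos h hn hm hd hsQ hvs
  have hlt := hsP.add_lt_vPt h hn hm hd hσ.le hsQ hs0 hs1
  have hseP : vPt d (expPt eP) = vPt d (expPt sP) := by rw [← heP.deg_eq, ← hsP.deg_eq]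
  have hseQ : vPt d (expPt eQ) = vPt d (expPt sQ) := by rw [← heQ.deg_eq, ← hsQ.deg_eq]
  have hwP : vPt d (expPt w) = vPt d (expPt sP) :=
    le_antisymm (hsP.vPt_le hw) (hmax _ hsP.coeff_ne)
  -- End points summing to (1,1) would give total degree ρ + σ, against `hlt`.
  have hedet : crossDet eP eQ = 0 := by
    refine heP.crossDet_eq_zero hinj' hE' h heQ fun heq => ?_
    have e0 : eP 0 + eQ 0 = 1 := by simpa using DFunLike.congr_fun heq 0
    have e1 : eP 1 + eQ 1 = 1 := by simpa using DFunLike.congr_fun heq 1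
    rw [← hseP, ← hseQ] at hlt
    simp only [vPt_expPt] at hlt
    have e0 : (eP 0 : ℤ) + eQ 0 = 1 := by exact_mod_cast e0
    have e1 : (eP 1 : ℤ) + eQ 1 = 1 := by exact_mod_cast e1
    have : d.1 * eP 0 + d.2 * eP 1 + (d.1 * eQ 0 + d.2 * eQ 1) = d.1 + d.2 := by
      linear_combination d.1 * e0 + d.2 * e1
    linarith
  obtain ⟨he0, he1⟩ := proportional_of_crossDet_eq_zero (n := n) (m := m) (hseP ▸ hx) hedet
    (by rw [hseP, hseQ, hvs])
  have hst1 : sP 1 < sP 0 := by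
    have h1 := hsP.vPt_snd_le hw hwP
    simp only [vPt_expPt] at h1
    have hle : sP 1 ≤ sP 0 := by omega
    -- The edge only gives a starting point on or below the diagonal; the diagonal is excluded by
    -- the commutator argument.
    refine lt_of_le_of_ne hle (hsP.ne_diag (hinj d hd) (diagWt_lexWt_pos _ hd) h ?_).symm
    intro h0
    have h1 : sP 1 = 0 := by omega
    simp [vPt_expPt, h0, h1] at hx
  have hen1 : eP 0 < eP 1 := by
    have h1 := heP.vPt_snd_le hu (huw.trans (hwP.trans hseP.symm))
    simp only [vPt_expPt] at h1
    omega
  have hneP : eP ≠ sP := by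
    rintro rfl
    omega
  -- Both ends for Q are proportional to those for P with the same ratio, so they differ too.
  have hneQ : eQ ≠ sQ := by
    rintro rfl
    have e0 := mul_left_cancel₀ hn.ne' (he0.trans hs0.symm)
    have e1 := mul_left_cancel₀ hn.ne' (he1.trans hs1.symm)
    omega
  have hy0 : (vPt d (expPt sQ) : ℚ) ≠ 0 := by exact_mod_cast hy.ne'
  have hx0 : (vPt d (expPt sP) : ℚ) ≠ 0 := by exact_mod_cast hx.ne'
  have hvs' : (n : ℚ) * vPt d (expPt sP) = m * vPt d (expPt sQ) := by exact_mod_cast hvs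
  have hn0 : (n : ℚ) ≠ 0 := by exact_mod_cast hn.ne'
  refine ⟨d, ⟨hsP.mem_Dir hdir heP.coeff_ne hseP hneP, hsQ.mem_Dir hdir heQ.coeff_ne hseQ hneQ⟩,
    hσ, ?_, bracket_eq_zero h hd hsP hsQ hlt, ?_, ⟨?_, ?_⟩, ?_, ?_⟩
  · rw [hsP.deg_eq, hsQ.deg_eq]; exact ⟨hx, hy⟩
  · rw [hsP.deg_eq, hsQ.deg_eq, div_eq_div_iff hy0 hn0]
    linear_combination hvs'
  · intro k hk
    rw [hsP.deg_eq, hsQ.deg_eq, div_eq_iff hx0] at hk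
    refine hmin.deg_ne_mul hpT hp0 hp1 k ?_
    rw [← hmdef, ← hndef]
    have : (n : ℚ) = k * m := mul_right_cancel₀ hx0 (by rw [hvs', hk]; ring)
    exact_mod_cast this
  · intro k hk
    rw [hsP.deg_eq, hsQ.deg_eq, div_eq_iff hy0] at hk
    refine hmin.swap.deg_ne_mul hqT hq0 hq1 k ?_
    rw [Weyl.deg_neg, ← hmdef, ← hndef]
    have : (m : ℚ) = k * n := mul_right_cancel₀ hy0 (by rw [← hvs', hk]; ring)
    exact_mod_cast this
  · rw [hsP.st_eq hd]
    simp only [vPt_expPt]; omega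
  · rw [heP.en_eq hd]
    simp only [vPt_expPt]; omega
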